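/- Let $G=(V,E)$ be a finite connected simple graph with $n=|V|\ge 2$ vertices, $m=|E|$ edges, vertex degrees $d(v)$ and maximum degree $\Delta(G)$, and let $x\in(0,1)$ (for the zero-field ferromagnetic Ising model on $G$ at inverse temperature $\beta>0$, $x=\tanh\beta$). For $A\subseteq E$ let $\partial A$ be the set of vertices of odd degree in $(V,A)$, let $\mathcal C_k=\{A\subseteq E: |\partial A|=k\}$, and let $\mathcal W=\mathcal C_0\cup\mathcal C_2$. Let $\pi$ be the probability distribution on $\mathcal W$ with $\pi(A)\propto n\,x^{|A|}$ for $A\in\mathcal C_0$ and $\pi(A)\propto 2\,x^{|A|}$ for $A\in\mathcal C_2$. The lazy Prokofiev–Svistunov (worm) chain on $\mathcal W$ has the following transition matrix $P$. From state $A$, choose a vertex $u$ uniformly at random from $V$ if $A\in\mathcal C_0$, and uniformly at random from $\partial A$ if $A\in\mathcal C_2$; choose a uniformly random neighbour $v$ of $u$ in $G$; with probability $a(A,A\triangle uv)$ move to $A\triangle uv$, and otherwise stay at $A$. Here $$a(A,A\triangle uv)=\frac12\begin{cases}\min\left(1,\frac{d(u)}{d(v)}x^{\pm}\right), & A,\ A\triangle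 uv\in\mathcal C_2,\ u\in\partial A,\\ \min(1,x^{\pm}), & \text{otherwise,}\end{cases}$$ where $x^{\pm}=x$ if $uv\notin A$ (the edge is added) and $x^{\pm}=1/x$ if $uv\in A$ (the edge is removed). For $\delta\in(0,1)$ the mixing time is $$t_{\mathrm{mix}}(\delta)=\min\Big\{t\in\mathbb N:\ \max_{A\in\mathcal W}\|P^t(A,\cdot)-\pi\|_{\mathrm{TV}}\le\delta\Big\},\qquad \|\mu-\nu\|_{\mathrm{TV}}=\max_{S\subseteq\mathcal W}|\mu(S)-\nu(S)|.$$ Then for every $\delta\in(0,1)$ this minimum exists and $$t_{\mathrm{mix}}(\delta)\le\frac{1}{2x}\left(\log\frac{8}{x}-\frac{\log\delta}{m}\right)\left(3+\frac{1}{mx}\right)\Delta(G)\,n^6\,m^2 .$$ -/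

import Mathlib

open scoped symmDiff

noncomputable section

namespace MarkovMixing

/-- Total variation distance `max_{S ⊆ Ω} |μ(S) - ν(S)|` of two measures on a finite set,
given by their mass functions. -/
def tvDist {Ω : Type*} [Fintype Ω] (μ ν : Ω → ℝ) : ℝ :=
  ⨆ S : Finset Ω, |∑ a ∈ S, μ a - ∑ a ∈ S, ν a|

/-- Distance to `π` after `t` steps from a worst initial state. -/
def worstDist {Ω : Type*} [Fintype Ω] [DecidableEq Ω] (P : Matrix Ω Ω ℝ) (π : Ω → ℝ)
    (t : ℕ) : ℝ :=
  ⨆ s : Ω, tvDist ((P ^ t) s) π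

/-- `t` is the mixing time: the minimum of the (in particular non-empty) set of times at which
the worst-case distance to `π` is at most `δ`. -/
def IsMixingTime {Ω : Type*} [Fintype Ω] [DecidableEq Ω] (P : Matrix Ω Ω ℝ) (π : Ω → ℝ)
    (δ : ℝ) (t : ℕ) : Prop :=
  IsLeast {t : ℕ | worstDist P π t ≤ δ} t

end MarkovMixing

namespace Worm

variable {V : Type*} [Fintype V] [DecidableEq V]

/-- `∂A`: the vertices of odd degree in the spanning subgraph `(V, A)`. -/
def boundary (A : Finset (Sym2 V)) : Finset V :=
  {v | Odd (A.filter fun e => v ∈ e).card}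

variable (G : SimpleGraph V) [DecidableRel G.Adj]

/-- `C_k`: the edge sets `A ⊆ E` with exactly `k` odd vertices. -/
def config (k : ℕ) : Finset (Finset (Sym2 V)) :=
  {A ∈ G.edgeFinset.powerset | (boundary A).card = k}

/-- The configuration space `C_0 ∪ C_2`. -/
abbrev State : Type _ := {A : Finset (Sym2 V) // A ∈ config G 0 ∪ config G 2}

/-- Unnormalized stationary weight: `n x^|A|` on `C_0` and `2 x^|A|` on `C_2`. -/
def weight (x : ℝ) (A : State G) : ℝ :=
  x ^ A.1.card * (if A.1 ∈ config G 0 then (Fintype.card V : ℝ) else 2)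

/-- The stationary distribution. -/
def stationary (x : ℝ) (A : State G) : ℝ :=
  weight G x A / ∑ B : State G, weight G x B

/-- The set from which the vertex `u` is drawn uniformly: `V` on `C_0`, and `∂A` on `C_2`. -/
def startSet (A : Finset (Sym2 V)) : Finset V :=
  if A ∈ config G 0 then Finset.univ else boundary A

/-- `x^±` for the flip of the edge `e`: `1/x` if `e` is removed, `x` if it is added. -/
def flipFactor (x : ℝ) (A : Finset (Sym2 V)) (e : Sym2 V) : ℝ :=
  if e ∈ A then x⁻¹ else x

/-- Lazy Metropolis acceptance probability `a(A, A ∆ uv)`, where `u` is the vertex drawn first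
and `v` the chosen neighbour of `u`. -/
def accept (x : ℝ) (A : Finset (Sym2 V)) (u v : V) : ℝ :=
  if A ∈ config G 2 ∧ A ∆ {s(u, v)} ∈ config G 2 ∧ u ∈ boundary A then
    1 / 2 * min 1 ((G.degree u : ℝ) / (G.degree v : ℝ) * flipFactor x A s(u, v))
  else
    1 / 2 * min 1 (flipFactor x A s(u, v))

/-- Transition matrix of the lazy Prokofiev–Svistunov chain: draw `u` uniformly from
`startSet A`, draw a uniform neighbour `v` of `u`, then move to `A ∆ uv` with probability
`accept G x A u v` and stay at `A` otherwise. -/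
def transition (x : ℝ) : Matrix (State G) (State G) ℝ := fun A B =>
  ∑ u ∈ startSet G A.1, (1 / ((startSet G A.1).card : ℝ)) *
    ∑ v ∈ G.neighborFinset u, (1 / (G.degree u : ℝ)) *
      ((if B.1 = A.1 ∆ {s(u, v)} then accept G x A.1 u v else 0) +
        (if B = A then 1 - accept G x A.1 u v else 0))

end Worm

end

/-! The argument bounds a Poincaré constant by canonical paths and converts it into a mixing time.

For a lazy chain `2 P - 1` is still stochastic, hence an `L²(π)` contraction, and so one step lowers
the second moment by at least the Dirichlet form. A Poincaré constant `C` therefore gives decay by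
`1 - 1 / C` per step. Testing on centred indicators and dividing by a lower bound for `π` bounds
total variation (`worstDist_le`).

For the worm chain, `∂` is additive mod 2, so adding a configuration `F ∈ C_0` preserves `C_0 ∪
C_2`. Peeling `D` edge by edge (`exists_peeling`) gives a path from `F ∆ D` to `F` of length at most
`m` inside the state space. If `S ⊆ D` is what remains of `D`, the path visits `A = F ∆ S`, and `|F|
+ |F ∆ D| = |A| + |A ∆ D|`: the weight of the pair factors through `A`, and `F` is recovered from
`A`, `D` and the edge. The congestion thus reduces to `∑_D x^|A ∆ D|`, which the high-temperature
expansion and `|correlation| ≤ 1` bound by `n² ∑_{B ∈ C_0} x^|B|` (`sum_worm_symmDiff_le`).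

Paths ending in `C_0` suffice, because a variance is at most the second moment about any constant,
here the `C_0`-average. As every flip carries flow at least `x^|A| x / (2 Δ)`, the Poincaré constant
is `4 Δ n³ m / x` (`poincare`). With `π ≥ (x / 4) ^ m` this implies the stated bound, since `n³ ≥
8`. -/

namespace MarkovMixing

/-! ### From a Poincaré inequality to the mixing time of a lazy chain. -/

variable {Ω : Type*} [Fintype Ω]

/-- The Dirichlet form of the kernel `P` with respect to `π`. -/
noncomputable def dirichlet (P : Matrix Ω Ω ℝ) (π f : Ω → ℝ) : ℝ :=
  1 / 2 * ∑ a, ∑ b, π a * P a b * (f a - f b) ^ 2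

/-- `P` is a stochastic matrix with holding probabilities at least `1 / 2`, and `π` is a
stationary probability distribution of it. -/
structure IsLazyStationary (P : Matrix Ω Ω ℝ) (π : Ω → ℝ) : Prop where
  nonneg : ∀ a b, 0 ≤ P a b
  row_sum : ∀ a, ∑ b, P a b = 1
  lazy : ∀ a, 1 / 2 ≤ P a a
  prob_nonneg : ∀ a, 0 ≤ π a
  prob_sum : ∑ a, π a = 1
  stationary : ∀ b, ∑ a, π a * P a b = π b

namespace IsLazyStationary

variable {P : Matrix Ω Ω ℝ} {π : Ω → ℝ}

theorem sum_mulVec (h : IsLazyStationary P π) (f : Ω → ℝ) :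
    ∑ a, π a * (P.mulVec f) a = ∑ a, π a * f a := by
  simp only [Matrix.mulVec, dotProduct, Finset.mul_sum]
  rw [Finset.sum_comm]
  refine Finset.sum_congr rfl fun b _ => ?_
  rw [← h.stationary b, Finset.sum_mul]
  exact Finset.sum_congr rfl fun a _ => by ring

/-- In the expanded square, row sums give one diagonal term and stationarity the other;
reversibility is not needed. -/
theorem dirichlet_eq (h : IsLazyStationary P π) (f : Ω → ℝ) :
    dirichlet P π f = ∑ a, π a * f a ^ 2 - ∑ a, π a * (f a * (P.mulVec f) a) := by
  have h1 : ∑ a, ∑ b, π a * P a b * f a ^ 2 = ∑ a, π a * f a ^ 2 :=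
    Finset.sum_congr rfl fun a _ => by
      rw [← Finset.sum_mul, ← Finset.mul_sum, h.row_sum, mul_one]
  have h2 : ∑ a, ∑ b, π a * P a b * f b ^ 2 = ∑ a, π a * f a ^ 2 := by
    rw [Finset.sum_comm]
    exact Finset.sum_congr rfl fun b _ => by rw [← Finset.sum_mul, h.stationary]
  have h3 : ∑ a, ∑ b, π a * P a b * (f a * f b) = ∑ a, π a * (f a * (P.mulVec f) a) :=
    Finset.sum_congr rfl fun a _ => by
      simp only [Matrix.mulVec, dotProduct, Finset.mul_sum]
      exact Finset.sum_congr rfl fun b _ => by ring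
  have h4 : ∑ a, ∑ b, π a * P a b * (f a - f b) ^ 2 =
      ∑ a, ∑ b, π a * P a b * f a ^ 2 + ∑ a, ∑ b, π a * P a b * f b ^ 2
        - 2 * ∑ a, ∑ b, π a * P a b * (f a * f b) := by
    simp only [Finset.mul_sum, ← Finset.sum_add_distrib, ← Finset.sum_sub_distrib]
    exact Finset.sum_congr rfl fun a _ => Finset.sum_congr rfl fun b _ => by ring
  rw [dirichlet, h4, h1, h2, h3]
  ring

/-- The second moment of `2 P f - f` is at most that of `f`, since `2 P - 1` is stochastic. -/
theorem sum_reflect_sq_le [DecidableEq Ω] (h : IsLazyStationary P π) (f : Ω → ℝ) :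
    ∑ a, π a * (2 * (P.mulVec f) a - f a) ^ 2 ≤ ∑ a, π a * f a ^ 2 := by
  set R : Ω → Ω → ℝ := fun a b => 2 * P a b - if b = a then 1 else 0 with hR
  have hR0 : ∀ a b, 0 ≤ R a b := fun a b => by
    by_cases hab : b = a
    · subst hab
      have := h.lazy b
      simp only [hR, if_true]
      linarith
    · have := h.nonneg a b
      simp only [hR, if_neg hab]
      linarith
  have hR1 : ∀ a, ∑ b, R a b = 1 := fun a => by
    simp only [hR, Finset.sum_sub_distrib, ← Finset.mul_sum, h.row_sum]
    simp
    norm_num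
  have hRf : ∀ a, ∑ b, R a b * f b = 2 * (P.mulVec f) a - f a := fun a => by
    simp only [hR, sub_mul, Finset.sum_sub_distrib, Matrix.mulVec, dotProduct, Finset.mul_sum,
      mul_assoc]
    simp
  have hRπ : ∀ b, ∑ a, π a * R a b = π b := fun b => by
    have := h.stationary b
    simp only [hR, mul_sub, Finset.sum_sub_distrib]
    simp only [mul_left_comm _ (2 : ℝ), ← Finset.mul_sum, this]
    simp
    ring
  -- Cauchy–Schwarz in each row of the stochastic kernel `R = 2 P - 1`.
  have hcs : ∀ a, (2 * (P.mulVec f) a - f a) ^ 2 ≤ ∑ b, R a b * f b ^ 2 := fun a => by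
    have := Finset.sum_sq_le_sum_mul_sum_of_sq_le_mul Finset.univ (r := fun b => R a b * f b)
      (f := fun b => R a b) (g := fun b => R a b * f b ^ 2) (fun b _ => hR0 a b)
      (fun b _ => mul_nonneg (hR0 a b) (sq_nonneg _)) (fun b _ => le_of_eq (by ring))
    rwa [hRf, hR1, one_mul] at this
  calc ∑ a, π a * (2 * (P.mulVec f) a - f a) ^ 2
      ≤ ∑ a, π a * ∑ b, R a b * f b ^ 2 :=
        Finset.sum_le_sum fun a _ => mul_le_mul_of_nonneg_left (hcs a) (h.prob_nonneg a)
    _ = ∑ a, π a * f a ^ 2 := by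
        simp only [Finset.mul_sum]
        rw [Finset.sum_comm]
        refine Finset.sum_congr rfl fun b _ => ?_
        rw [← hRπ b, Finset.sum_mul]
        exact Finset.sum_congr rfl fun a _ => by ring

/-- One step of a lazy chain decreases the second moment by at least the Dirichlet form. -/
theorem sum_mulVec_sq_le [DecidableEq Ω] (h : IsLazyStationary P π) (f : Ω → ℝ) :
    ∑ a, π a * (P.mulVec f) a ^ 2 ≤ ∑ a, π a * f a ^ 2 - dirichlet P π f := by
  have h1 := h.sum_reflect_sq_le f
  have h2 : ∑ a, π a * (2 * (P.mulVec f) a - f a) ^ 2 =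
      4 * ∑ a, π a * (P.mulVec f) a ^ 2 - 4 * ∑ a, π a * (f a * (P.mulVec f) a)
        + ∑ a, π a * f a ^ 2 := by
    simp only [Finset.mul_sum, ← Finset.sum_add_distrib, ← Finset.sum_sub_distrib]
    exact Finset.sum_congr rfl fun a _ => by ring
  -- `h1` and `h2` say that the second moment of `P f` is at most the inner product of `f` and `P
  -- f`.
  rw [h.dirichlet_eq]
  linarith

/-- A Poincaré inequality makes second moments of centred functions decay geometrically. -/
theorem sum_pow_mulVec_sq_le [DecidableEq Ω] (h : IsLazyStationary P π) {C : ℝ} (hC : 1 ≤ C)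
    (hP : ∀ f : Ω → ℝ, ∑ a, π a * f a = 0 → ∑ a, π a * f a ^ 2 ≤ C * dirichlet P π f)
    (f : Ω → ℝ) (hf : ∑ a, π a * f a = 0) (t : ℕ) :
    ∑ a, π a * ((P ^ t).mulVec f) a = 0 ∧
      ∑ a, π a * ((P ^ t).mulVec f) a ^ 2 ≤ (1 - 1 / C) ^ t * ∑ a, π a * f a ^ 2 := by
  have hC0 : 0 < C := by linarith
  have hr : 0 ≤ 1 - 1 / C := by
    rw [sub_nonneg, div_le_one hC0]
    exact hC
  induction t with
  | zero => simp [hf]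
  | succ t ih =>
    have e : (P ^ (t + 1)).mulVec f = P.mulVec ((P ^ t).mulVec f) := by
      rw [pow_succ', Matrix.mulVec_mulVec]
    rw [e]
    set g := (P ^ t).mulVec f
    refine ⟨by rw [h.sum_mulVec]; exact ih.1, ?_⟩
    have h1 := h.sum_mulVec_sq_le g
    have h2 : 1 / C * ∑ a, π a * g a ^ 2 ≤ dirichlet P π g := by
      rw [one_div, inv_mul_le_iff₀ hC0]
      exact hP g ih.1
    have h3 := mul_le_mul_of_nonneg_left ih.2 hr
    rw [pow_succ']
    linarith

theorem pow_row_sum [DecidableEq Ω] (h : IsLazyStationary P π) (t : ℕ) :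
    (P ^ t).mulVec 1 = 1 := by
  have h1 : P.mulVec 1 = 1 := by
    ext a
    simp [Matrix.mulVec, dotProduct, h.row_sum]
  induction t with
  | zero => simp
  | succ t ih => rw [pow_succ, ← Matrix.mulVec_mulVec, h1, ih]

/-- The discrepancy on an event `S` from the start `s` is the value at `s` of `P ^ t` applied to the
centred indicator of `S`. One point carries mass at least `p`, so the second moment controls that
value. -/
theorem worstDist_le [DecidableEq Ω] [Nonempty Ω] (h : IsLazyStationary P π) {C p δ : ℝ}
    (hC : 1 ≤ C)
    (hP : ∀ f : Ω → ℝ, ∑ a, π a * f a = 0 → ∑ a, π a * f a ^ 2 ≤ C * dirichlet P π f)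
    (hp : 0 < p) (hpπ : ∀ a, p ≤ π a) (hδ : 0 ≤ δ) {t : ℕ}
    (ht : (1 - 1 / C) ^ t ≤ δ ^ 2 * p) : worstDist P π t ≤ δ := by
  refine ciSup_le fun s => ciSup_le fun S => ?_
  set c := ∑ a ∈ S, π a with hc
  have hind : ∀ q : Ω → ℝ, ∑ a, q a * (if a ∈ S then 1 else 0) = ∑ a ∈ S, q a := fun q => by
    simp
  set f : Ω → ℝ := fun a => (if a ∈ S then 1 else 0) - c with hf
  have hmean : ∑ a, π a * f a = 0 := by
    simp only [hf, mul_sub, Finset.sum_sub_distrib, ← Finset.sum_mul, hind, h.prob_sum]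
    simp [hc]
  have hc0 : 0 ≤ c := Finset.sum_nonneg fun a _ => h.prob_nonneg a
  have hc1 : c ≤ 1 := by
    rw [← h.prob_sum]
    exact Finset.sum_le_sum_of_subset_of_nonneg (Finset.subset_univ S)
      fun a _ _ => h.prob_nonneg a
  have hf1 : ∑ a, π a * f a ^ 2 ≤ 1 := by
    rw [← h.prob_sum]
    refine Finset.sum_le_sum fun a _ => mul_le_of_le_one_right (h.prob_nonneg a) ?_
    simp only [hf]
    split_ifs <;> nlinarith
  have hval : ((P ^ t).mulVec f) s = ∑ a ∈ S, (P ^ t) s a - c := by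
    have h1 : ∑ a, (P ^ t) s a = 1 := by
      have := congrFun (h.pow_row_sum t) s
      simpa [Matrix.mulVec, dotProduct] using this
    simp only [Matrix.mulVec, dotProduct, hf, mul_sub, Finset.sum_sub_distrib, ← Finset.sum_mul,
      hind, h1, one_mul]
  have hr : 0 ≤ 1 - 1 / C := by
    rw [sub_nonneg, div_le_one (by linarith)]
    exact hC
  have hdecay := (h.sum_pow_mulVec_sq_le hC hP f hmean t).2
  have hs : p * ((P ^ t).mulVec f) s ^ 2 ≤ p * δ ^ 2 := by
    calc p * ((P ^ t).mulVec f) s ^ 2 ≤ π s * ((P ^ t).mulVec f) s ^ 2 :=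
          mul_le_mul_of_nonneg_right (hpπ s) (sq_nonneg _)
      _ ≤ ∑ a, π a * ((P ^ t).mulVec f) a ^ 2 :=
          Finset.single_le_sum (f := fun a => π a * ((P ^ t).mulVec f) a ^ 2)
            (fun a _ => mul_nonneg (h.prob_nonneg a) (sq_nonneg _)) (Finset.mem_univ s)
      _ ≤ (1 - 1 / C) ^ t * ∑ a, π a * f a ^ 2 := hdecay
      _ ≤ (1 - 1 / C) ^ t := mul_le_of_le_one_right (pow_nonneg hr t) hf1
      _ ≤ p * δ ^ 2 := by linarith
  rw [← hval]
  exact abs_le_of_sq_le_sq (le_of_mul_le_mul_left hs hp) hδ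

end IsLazyStationary

theorem exists_isMixingTime_le [DecidableEq Ω] {P : Matrix Ω Ω ℝ} {π : Ω → ℝ} {δ : ℝ} {t : ℕ}
    (h : worstDist P π t ≤ δ) : ∃ s, IsMixingTime P π δ s ∧ s ≤ t := by
  classical
  have hex : ∃ t, worstDist P π t ≤ δ := ⟨t, h⟩
  exact ⟨Nat.find hex, ⟨Nat.find_spec hex, fun s hs => Nat.find_min' hex hs⟩,
    Nat.find_min' hex h⟩

end MarkovMixing

/-! ### Algebra of worm configurations and their peeling. -/

namespace Worm

variable {V : Type*} [Fintype V] [DecidableEq V]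

theorem mem_boundary {A : Finset (Sym2 V)} {v : V} :
    v ∈ boundary A ↔ Odd (A.filter fun e => v ∈ e).card := by
  simp [boundary]

theorem boundary_symmDiff (A B : Finset (Sym2 V)) :
    boundary (A ∆ B) = boundary A ∆ boundary B := by
  ext v
  have h : ((A ∆ B).filter fun e => v ∈ e) =
      (A.filter fun e => v ∈ e) ∆ (B.filter fun e => v ∈ e) := by
    ext e
    simp only [Finset.mem_filter, Finset.mem_symmDiff]
    tauto
  rw [Finset.mem_symmDiff, mem_boundary, mem_boundary, mem_boundary, h]
  generalize (A.filter fun e => v ∈ e) = X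
  generalize (B.filter fun e => v ∈ e) = Y
  have h1 : (X ∆ Y).card = (X \ Y).card + (Y \ X).card := by
    rw [symmDiff_def]
    exact Finset.card_union_of_disjoint disjoint_sdiff_sdiff
  have h2 := Finset.card_sdiff_add_card_inter X Y
  have h3 := Finset.card_sdiff_add_card_inter Y X
  rw [Finset.inter_comm] at h3
  rw [h1]
  simp only [Nat.odd_iff]
  omega

theorem boundary_empty : boundary (∅ : Finset (Sym2 V)) = ∅ := by
  ext v
  simp [mem_boundary]

theorem boundary_singleton (u v : V) : boundary {s(u, v)} = {u, v} := by
  ext w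
  rw [mem_boundary, Finset.filter_singleton]
  by_cases h : w ∈ s(u, v)
  · rw [if_pos h]
    simpa using h
  · rw [if_neg h]
    simpa using h

theorem card_symmDiff_pair {T : Finset V} {u v : V} (hT : T.card = 2) (hu : u ∈ T)
    (huv : u ≠ v) : (T ∆ {u, v}).card = 0 ∧ T = {u, v} ∨ (T ∆ {u, v}).card = 2 ∧ v ∉ T := by
  by_cases hv : v ∈ T
  · left
    have : T = {u, v} := (Finset.eq_of_subset_of_card_le
      (Finset.insert_subset hu (Finset.singleton_subset_iff.2 hv))
      (by rw [hT, Finset.card_pair huv])).symm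
    exact ⟨by rw [this, symmDiff_self]; rfl, this⟩
  · right
    refine ⟨?_, hv⟩
    have : T ∆ {u, v} = insert v (T.erase u) := by
      ext w
      simp only [Finset.mem_symmDiff, Finset.mem_insert, Finset.mem_singleton, Finset.mem_erase]
      by_cases h1 : w = u
      · subst h1; simp [hu, huv]
      · by_cases h2 : w = v
        · subst h2; simp [hv]
        · simp [h1, h2]
    rw [this, Finset.card_insert_of_notMem (by simp [hv]), Finset.card_erase_of_mem hu, hT]

variable (G : SimpleGraph V) [DecidableRel G.Adj]

theorem mem_config {k : ℕ} {A : Finset (Sym2 V)} :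
    A ∈ config G k ↔ A ⊆ G.edgeFinset ∧ (boundary A).card = k := by
  simp [config]

theorem mem_worm {A : Finset (Sym2 V)} : A ∈ config G 0 ∪ config G 2 ↔
    A ⊆ G.edgeFinset ∧ ((boundary A).card = 0 ∨ (boundary A).card = 2) := by
  rw [Finset.mem_union, mem_config, mem_config]
  tauto

theorem mem_config_zero {A : Finset (Sym2 V)} :
    A ∈ config G 0 ↔ A ⊆ G.edgeFinset ∧ boundary A = ∅ := by
  rw [mem_config, Finset.card_eq_zero]

theorem empty_mem_config_zero : ∅ ∈ config G 0 := by
  rw [mem_config_zero]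
  exact ⟨Finset.empty_subset _, boundary_empty⟩

theorem symmDiff_subset_edgeFinset {A B : Finset (Sym2 V)} (hA : A ⊆ G.edgeFinset)
    (hB : B ⊆ G.edgeFinset) : A ∆ B ⊆ G.edgeFinset := fun e he => by
  rcases Finset.mem_symmDiff.1 he with h | h
  · exact hA h.1
  · exact hB h.1

theorem symmDiff_mem_worm {F D : Finset (Sym2 V)} (hF : F ∈ config G 0)
    (hD : D ∈ config G 0 ∪ config G 2) : F ∆ D ∈ config G 0 ∪ config G 2 := by
  rw [mem_config_zero] at hF
  rw [mem_worm] at hD ⊢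
  refine ⟨symmDiff_subset_edgeFinset G hF.1 hD.1, ?_⟩
  rw [boundary_symmDiff, hF.2, ← Finset.bot_eq_empty, bot_symmDiff]
  exact hD.2

/-- An edge can be removed from any nonempty worm configuration without leaving the
configuration space. -/
theorem exists_erase_mem_worm {D : Finset (Sym2 V)} (hD : D ∈ config G 0 ∪ config G 2)
    (hne : D.Nonempty) : ∃ e ∈ D, D ∆ {e} ∈ config G 0 ∪ config G 2 := by
  rw [mem_worm] at hD
  -- Any edge may leave a closed configuration. From one with two odd vertices, an edge at an odd
  -- vertex is taken, which moves that defect or annihilates the pair.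
  have key : ∃ u v, s(u, v) ∈ D ∧
      ((boundary D).card = 0 ∨ (boundary D).card = 2 ∧ u ∈ boundary D) := by
    rcases hD.2 with h | h
    · obtain ⟨e, he⟩ := hne
      induction e using Sym2.ind with
      | _ u v => exact ⟨u, v, he, Or.inl h⟩
    · obtain ⟨u, hu⟩ : (boundary D).Nonempty := by
        rw [← Finset.card_pos]
        omega
      obtain ⟨e, he⟩ := Finset.card_pos.1 (mem_boundary.1 hu).pos
      obtain ⟨v, rfl⟩ := (Finset.mem_filter.1 he).2
      exact ⟨u, v, (Finset.mem_filter.1 he).1, Or.inr ⟨h, hu⟩⟩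
  obtain ⟨u, v, he, h⟩ := key
  have huv : u ≠ v := by
    have := hD.1 he
    rw [SimpleGraph.mem_edgeFinset, SimpleGraph.mem_edgeSet] at this
    exact this.ne
  refine ⟨_, he, (mem_worm G).2 ⟨symmDiff_subset_edgeFinset G hD.1
    (Finset.singleton_subset_iff.2 (hD.1 he)), ?_⟩⟩
  rw [boundary_symmDiff, boundary_singleton]
  rcases h with h | ⟨h, hu⟩
  · rw [Finset.card_eq_zero.1 h, ← Finset.bot_eq_empty, bot_symmDiff]
    exact Or.inr (Finset.card_pair huv)
  · rcases card_symmDiff_pair h hu huv with h' | h'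
    · exact Or.inl h'.1
    · exact Or.inr h'.1

/-- Peeling a worm configuration `D` edge by edge: `S e` is the part of `D` that is left just
before `e` is removed. -/
theorem exists_peeling (D : Finset (Sym2 V)) (hD : D ∈ config G 0 ∪ config G 2) :
    ∃ S : Sym2 V → Finset (Sym2 V),
      (∀ e ∈ D, S e ⊆ D ∧ S e ∈ config G 0 ∪ config G 2 ∧
        S e ∆ {e} ∈ config G 0 ∪ config G 2) ∧
      ∀ h : Finset (Sym2 V) → ℝ, h D - h ∅ = ∑ e ∈ D, (h (S e) - h (S e ∆ {e})) := by
  induction hk : D.card generalizing D with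
  | zero =>
    rw [Finset.card_eq_zero] at hk
    subst hk
    exact ⟨fun _ => ∅, by simp, by simp⟩
  | succ k ih =>
    obtain ⟨e, he, hDe⟩ := exists_erase_mem_worm G hD (Finset.card_pos.1 (by omega))
    have hers : D ∆ {e} = D.erase e := by
      ext a
      simp only [Finset.mem_symmDiff, Finset.mem_singleton, Finset.mem_erase]
      by_cases h : a = e
      · subst h; simp [he]
      · simp [h]
    have hc : (D ∆ {e}).card = k := by rw [hers, Finset.card_erase_of_mem he, hk]; rfl
    obtain ⟨S, hS, hsum⟩ := ih _ hDe hc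
    have hne : ∀ a ∈ D.erase e, a ≠ e := fun a ha => (Finset.mem_erase.1 ha).1
    refine ⟨Function.update S e D, fun a ha => ?_, fun h => ?_⟩
    · by_cases hae : a = e
      · subst hae
        rw [Function.update_self]
        exact ⟨subset_rfl, hD, hDe⟩
      · rw [Function.update_of_ne hae]
        have := hS a (by rw [hers]; exact Finset.mem_erase.2 ⟨hae, ha⟩)
        exact ⟨this.1.trans (by rw [hers]; exact Finset.erase_subset _ _), this.2⟩
    · rw [← Finset.add_sum_erase D _ he, Function.update_self]
      have h1 := hsum h
      rw [hers] at h1 ⊢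
      have h2 : ∑ a ∈ D.erase e,
          (h (Function.update S e D a) - h (Function.update S e D a ∆ {a})) =
          ∑ a ∈ D.erase e, (h (S a) - h (S a ∆ {a})) :=
        Finset.sum_congr rfl fun a ha => by rw [Function.update_of_ne (hne a ha)]
      rw [h2, ← h1]
      ring

/-- Adding `S` exchanges membership in `F` and in `F ∆ D` at each point of `S ⊆ D`, and changes
nothing elsewhere. This moves the weight of a pair of path endpoints to an intermediate state. -/
theorem card_add_card_symmDiff {α : Type*} [DecidableEq α] [Fintype α] {F D S : Finset α}
    (h : S ⊆ D) : F.card + (F ∆ D).card = (F ∆ S).card + ((F ∆ S) ∆ D).card := by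
  have key : ∀ X : Finset α, X.card = ∑ a, if a ∈ X then 1 else 0 := fun X => by simp
  rw [key F, key (F ∆ D), key (F ∆ S), key ((F ∆ S) ∆ D), ← Finset.sum_add_distrib,
    ← Finset.sum_add_distrib]
  refine Finset.sum_congr rfl fun a _ => ?_
  have := @h a
  by_cases h1 : a ∈ F <;> by_cases h2 : a ∈ S <;> by_cases h3 : a ∈ D <;>
    simp_all [Finset.mem_symmDiff]

/-! ### High-temperature expansion and correlation bounds. -/

/-- The parity character of the vertex set `S` at `T`. -/
def parityChar (S T : Finset V) : ℝ := ∏ v ∈ S, if v ∈ T then -1 else 1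

theorem parityChar_mul_self {U : Type*} [DecidableEq U] (S T : Finset U) :
    parityChar S T * parityChar S T = 1 := by
  rw [parityChar, ← Finset.prod_mul_distrib]
  refine Finset.prod_eq_one fun v _ => ?_
  split_ifs <;> norm_num

theorem abs_parityChar {U : Type*} [DecidableEq U] (S T : Finset U) : |parityChar S T| = 1 := by
  have h := parityChar_mul_self S T
  rw [← abs_mul_abs_self] at h
  nlinarith [abs_nonneg (parityChar S T)]

/-- With `S` read as the set of minus spins, each edge contributes the product of the spins at its
ends. The spin at `v` occurs once per edge of `B` at `v`, so only odd vertices survive. -/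
theorem prod_parityChar_toFinset (S : Finset V) (B : Finset (Sym2 V)) :
    ∏ e ∈ B, parityChar S {v | v ∈ e} = parityChar S (boundary B) := by
  simp only [parityChar]
  rw [Finset.prod_comm]
  refine Finset.prod_congr rfl fun v _ => ?_
  simp only [Finset.mem_filter, Finset.mem_univ, true_and]
  rw [Finset.prod_ite, Finset.prod_const_one, mul_one, Finset.prod_const]
  by_cases h : v ∈ boundary B
  · rw [if_pos h, (mem_boundary.1 h).neg_one_pow]
  · rw [if_neg h, Even.neg_one_pow]
    rwa [mem_boundary, Nat.not_odd_iff_even] at h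

/-- Orthogonality of characters: the sum over `S` factors over vertices, and a vertex where `T` and
`U` differ gives `1 - 1 = 0`. -/
theorem sum_parityChar_mul (T U : Finset V) :
    ∑ S : Finset V, parityChar S T * parityChar S U =
      if T = U then (2 : ℝ) ^ Fintype.card V else 0 := by
  have h1 : ∑ S : Finset V, parityChar S T * parityChar S U =
      ∏ v : V, (1 + (if v ∈ T then (-1 : ℝ) else 1) * (if v ∈ U then -1 else 1)) := by
    rw [Finset.prod_one_add, Finset.powerset_univ]
    simp only [parityChar, Finset.prod_mul_distrib]
  rw [h1]
  split_ifs with h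
  · subst h
    rw [← Finset.card_univ, ← Finset.prod_const]
    refine Finset.prod_congr rfl fun v _ => ?_
    split_ifs <;> norm_num
  · obtain ⟨v, hv⟩ : ∃ v, ¬ (v ∈ T ↔ v ∈ U) := by
      by_contra! h'
      exact h (Finset.ext h')
    refine Finset.prod_eq_zero (Finset.mem_univ v) ?_
    by_cases h1 : v ∈ T <;> by_cases h2 : v ∈ U <;> simp_all

/-- The high-temperature expansion. -/
theorem sum_parityChar_prod (E : Finset (Sym2 V)) (x : ℝ) (T : Finset V) :
    ∑ S : Finset V, parityChar S T * ∏ e ∈ E, (1 + x * parityChar S {v | v ∈ e}) =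
      2 ^ Fintype.card V * ∑ B ∈ E.powerset with boundary B = T, x ^ B.card := by
  have h1 : ∀ S : Finset V, parityChar S T * ∏ e ∈ E, (1 + x * parityChar S {v | v ∈ e}) =
      ∑ B ∈ E.powerset, x ^ B.card * (parityChar S T * parityChar S (boundary B)) := fun S => by
    rw [Finset.prod_one_add, Finset.mul_sum]
    refine Finset.sum_congr rfl fun B _ => ?_
    rw [Finset.prod_mul_distrib, Finset.prod_const, prod_parityChar_toFinset]
    ring
  simp only [h1]
  rw [Finset.sum_comm, Finset.sum_filter, Finset.mul_sum]
  refine Finset.sum_congr rfl fun B _ => ?_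
  rw [← Finset.mul_sum, sum_parityChar_mul]
  by_cases h : boundary B = T
  · rw [if_pos h, if_pos h.symm, mul_comm]
  · rw [if_neg h, if_neg (Ne.symm h), mul_zero, mul_zero]

/-- Correlations of spins are at most `1`, in terms of the high-temperature expansion. -/
theorem sum_boundary_eq_le (E : Finset (Sym2 V)) {x : ℝ} (hx : x ∈ Set.Ioo (0 : ℝ) 1)
    (T : Finset V) : ∑ B ∈ E.powerset with boundary B = T, x ^ B.card ≤
      ∑ B ∈ E.powerset with boundary B = ∅, x ^ B.card := by
  refine le_of_mul_le_mul_left ?_ (pow_pos (two_pos (α := ℝ)) (Fintype.card V))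
  rw [← sum_parityChar_prod, ← sum_parityChar_prod]
  refine Finset.sum_le_sum fun S _ => ?_
  have h1 : parityChar S (∅ : Finset V) = 1 := by simp [parityChar]
  rw [h1]
  refine mul_le_mul_of_nonneg_right ?_ (Finset.prod_nonneg fun e _ => ?_)
  · rw [← abs_parityChar S T]
    exact le_abs_self _
  · have := abs_parityChar S {v | v ∈ e}
    have h2 := neg_abs_le (parityChar S {v | v ∈ e})
    rw [this] at h2
    nlinarith [hx.1, hx.2]

/-- There are `1 + n.choose 2 ≤ n²` possible boundaries `T` of `D`. For each, `D ↦ A ∆ D` is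
injective into the edge sets with boundary `∂A ∆ T`, whose total weight is at most that of `C_0`. -/
theorem sum_worm_symmDiff_le {x : ℝ} (hx : x ∈ Set.Ioo (0 : ℝ) 1) (hn : 1 ≤ Fintype.card V)
    {A : Finset (Sym2 V)} (hA : A ⊆ G.edgeFinset) :
    ∑ D ∈ config G 0 ∪ config G 2, x ^ (A ∆ D).card ≤
      (Fintype.card V : ℝ) ^ 2 * ∑ B ∈ config G 0, x ^ B.card := by
  set Λ := ∑ B ∈ config G 0, x ^ B.card with hΛ
  have hΛ' : Λ = ∑ B ∈ G.edgeFinset.powerset with boundary B = ∅, x ^ B.card := by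
    rw [hΛ]
    congr 1
    ext B
    rw [mem_config_zero]
    simp
  have hΛ0 : 0 ≤ Λ := Finset.sum_nonneg fun B _ => pow_nonneg hx.1.le _
  set 𝒯 : Finset (Finset V) := Finset.powersetCard 0 Finset.univ ∪
    Finset.powersetCard 2 Finset.univ with h𝒯
  have hcard : (𝒯.card : ℝ) ≤ (Fintype.card V : ℝ) ^ 2 := by
    have h1 : 𝒯.card ≤ 1 + (Fintype.card V).choose 2 := by
      refine (Finset.card_union_le _ _).trans ?_
      rw [Finset.card_powersetCard, Finset.card_powersetCard, Finset.card_univ]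
      simp
    have h2 : 1 + (Fintype.card V).choose 2 ≤ Fintype.card V ^ 2 := by
      obtain ⟨k, hk⟩ : ∃ k, Fintype.card V = k + 1 := ⟨Fintype.card V - 1, by omega⟩
      rw [hk, Nat.choose_two_right]
      have := Nat.div_le_self ((k + 1) * (k + 1 - 1)) 2
      simp only [Nat.add_sub_cancel] at this ⊢
      nlinarith
    exact_mod_cast h1.trans h2
  have hmaps : ∀ D ∈ config G 0 ∪ config G 2, boundary D ∈ 𝒯 := fun D hD => by
    rw [mem_worm] at hD
    rw [h𝒯, Finset.mem_union, Finset.mem_powersetCard, Finset.mem_powersetCard]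
    rcases hD.2 with h | h
    · exact Or.inl ⟨Finset.subset_univ _, h⟩
    · exact Or.inr ⟨Finset.subset_univ _, h⟩
  rw [← Finset.sum_fiberwise_of_maps_to hmaps]
  have hfib : ∀ T ∈ 𝒯, ∑ D ∈ config G 0 ∪ config G 2 with boundary D = T, x ^ (A ∆ D).card
      ≤ Λ := fun T _ => by
    rw [hΛ']
    refine le_trans ?_ (sum_boundary_eq_le G.edgeFinset hx (boundary A ∆ T))
    rw [← Finset.sum_image (f := fun B : Finset (Sym2 V) => x ^ B.card) (g := fun D => A ∆ D)
      (fun D _ D' _ h => symmDiff_right_injective A h)]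
    refine Finset.sum_le_sum_of_subset_of_nonneg (fun B hB => ?_)
      fun B _ _ => pow_nonneg hx.1.le _
    obtain ⟨D, hD, rfl⟩ := Finset.mem_image.1 hB
    rw [Finset.mem_filter, mem_worm] at hD
    rw [Finset.mem_filter, Finset.mem_powerset, boundary_symmDiff, hD.2]
    exact ⟨symmDiff_subset_edgeFinset G hA hD.1.1, rfl⟩
  calc _ ≤ ∑ T ∈ 𝒯, Λ := Finset.sum_le_sum hfib
    _ = 𝒯.card * Λ := by rw [Finset.sum_const, nsmul_eq_mul]
    _ ≤ _ := mul_le_mul_of_nonneg_right hcard hΛ0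

/-! ### Canonical paths and their congestion. -/

/-- Comparison of pair differences with differences along single edge flips. -/
theorem sum_sq_sub_le {x : ℝ} (hx : x ∈ Set.Ioo (0 : ℝ) 1) (hn : 1 ≤ Fintype.card V)
    (g : Finset (Sym2 V) → ℝ) :
    ∑ I ∈ config G 0 ∪ config G 2, ∑ F ∈ config G 0,
        x ^ I.card * x ^ F.card * (g I - g F) ^ 2 ≤
      (G.edgeFinset.card : ℝ) * ((Fintype.card V : ℝ) ^ 2 * ∑ B ∈ config G 0, x ^ B.card) *
        ∑ A ∈ config G 0 ∪ config G 2, ∑ e ∈ G.edgeFinset,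
          if A ∆ {e} ∈ config G 0 ∪ config G 2 then
            x ^ A.card * (g A - g (A ∆ {e})) ^ 2 else 0 := by
  set W := config G 0 ∪ config G 2 with hW
  set m : ℝ := (G.edgeFinset.card : ℝ)
  set Λ := ∑ B ∈ config G 0, x ^ B.card
  set Φ : Finset (Sym2 V) → Sym2 V → ℝ := fun A e =>
    if A ∆ {e} ∈ W then x ^ A.card * (g A - g (A ∆ {e})) ^ 2 else 0 with hΦ
  have hΦ0 : ∀ A e, 0 ≤ Φ A e := fun A e => by
    simp only [hΦ]
    split_ifs
    · exact mul_nonneg (pow_nonneg hx.1.le _) (sq_nonneg _)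
    · exact le_rfl
  choose! S hS hsum using exists_peeling G
  have hpath : ∀ F ∈ config G 0, ∀ D ∈ W,
      x ^ (F ∆ D).card * x ^ F.card * (g (F ∆ D) - g F) ^ 2 ≤
        m * ∑ e ∈ D, x ^ ((F ∆ S D e) ∆ D).card * Φ (F ∆ S D e) e := fun F hF D hD => by
    have hDE : D ⊆ G.edgeFinset := ((mem_worm G).1 hD).1
    have hDm : (D.card : ℝ) ≤ m := Nat.cast_le.2 (Finset.card_le_card hDE)
    have h1 := hsum D hD fun X => g (F ∆ X)
    have h0 : F ∆ ∅ = F := by rw [← Finset.bot_eq_empty, symmDiff_bot]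
    simp only [h0] at h1
    -- Telescoping along the peeling of `D`, then Cauchy–Schwarz over at most `m` steps.
    have h2 : (g (F ∆ D) - g F) ^ 2 ≤
        m * ∑ e ∈ D, (g (F ∆ S D e) - g (F ∆ (S D e ∆ {e}))) ^ 2 := by
      rw [h1]
      exact sq_sum_le_card_mul_sum_sq.trans
        (mul_le_mul_of_nonneg_right hDm (Finset.sum_nonneg fun _ _ => sq_nonneg _))
    refine (mul_le_mul_of_nonneg_left h2
      (mul_nonneg (pow_nonneg hx.1.le _) (pow_nonneg hx.1.le _))).trans_eq ?_
    rw [mul_left_comm, Finset.mul_sum]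
    congr 1
    refine Finset.sum_congr rfl fun e he => ?_
    obtain ⟨hs1, hs2, hs3⟩ := hS D hD e he
    have hmem : (F ∆ S D e) ∆ {e} ∈ W := by
      rw [symmDiff_assoc]
      exact symmDiff_mem_worm G hF hs3
    simp only [hΦ]
    rw [if_pos hmem, ← pow_add, add_comm, card_add_card_symmDiff hs1, pow_add,
      symmDiff_assoc F (S D e) {e}]
    ring
  calc ∑ I ∈ W, ∑ F ∈ config G 0, x ^ I.card * x ^ F.card * (g I - g F) ^ 2
      = ∑ F ∈ config G 0, ∑ D ∈ W,
          x ^ (F ∆ D).card * x ^ F.card * (g (F ∆ D) - g F) ^ 2 := by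
        rw [Finset.sum_comm]
        refine Finset.sum_congr rfl fun F hF => ?_
        refine Finset.sum_nbij' (fun I => F ∆ I) (fun D => F ∆ D)
          (fun I hI => symmDiff_mem_worm G hF hI) (fun D hD => symmDiff_mem_worm G hF hD)
          (fun I _ => symmDiff_symmDiff_cancel_left F I)
          (fun D _ => symmDiff_symmDiff_cancel_left F D) fun I _ => ?_
        rw [symmDiff_symmDiff_cancel_left]
    _ ≤ ∑ F ∈ config G 0, ∑ D ∈ W,
          m * ∑ e ∈ D, x ^ ((F ∆ S D e) ∆ D).card * Φ (F ∆ S D e) e :=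
        Finset.sum_le_sum fun F hF => Finset.sum_le_sum fun D hD => hpath F hF D hD
    _ = m * ∑ D ∈ W, ∑ e ∈ D, ∑ F ∈ config G 0,
          x ^ ((F ∆ S D e) ∆ D).card * Φ (F ∆ S D e) e := by
        rw [Finset.sum_comm, Finset.mul_sum]
        refine Finset.sum_congr rfl fun D _ => ?_
        rw [← Finset.mul_sum, Finset.sum_comm]
    _ ≤ m * ∑ D ∈ W, ∑ e ∈ G.edgeFinset, ∑ A ∈ W, x ^ (A ∆ D).card * Φ A e := by
        refine mul_le_mul_of_nonneg_left (Finset.sum_le_sum fun D hD => ?_) (Nat.cast_nonneg _)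
        have hnn : ∀ A e, 0 ≤ x ^ (A ∆ D).card * Φ A e := fun A e =>
          mul_nonneg (pow_nonneg hx.1.le _) (hΦ0 A e)
        refine le_trans (Finset.sum_le_sum fun e he => ?_)
          (Finset.sum_le_sum_of_subset_of_nonneg ((mem_worm G).1 hD).1
            fun e _ _ => Finset.sum_nonneg fun A _ => hnn A e)
        -- For fixed `D` and `e` the visited state determines `F`, so each `A` is counted at most
        -- once.
        rw [← Finset.sum_image (f := fun A => x ^ (A ∆ D).card * Φ A e)
          (g := fun F => F ∆ S D e) (fun F _ F' _ h => symmDiff_left_injective _ h)]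
        refine Finset.sum_le_sum_of_subset_of_nonneg (fun A hA => ?_) fun A _ _ => hnn A e
        obtain ⟨F, hF, rfl⟩ := Finset.mem_image.1 hA
        exact symmDiff_mem_worm G hF (hS D hD e he).2.1
    _ = m * ∑ A ∈ W, ∑ e ∈ G.edgeFinset, Φ A e * ∑ D ∈ W, x ^ (A ∆ D).card := by
        congr 1
        rw [Finset.sum_congr rfl fun D _ => Finset.sum_comm, Finset.sum_comm]
        refine Finset.sum_congr rfl fun A _ => ?_
        rw [Finset.sum_comm]
        refine Finset.sum_congr rfl fun e _ => ?_
        rw [Finset.mul_sum]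
        exact Finset.sum_congr rfl fun D _ => mul_comm _ _
    _ ≤ m * ∑ A ∈ W, ∑ e ∈ G.edgeFinset, Φ A e * ((Fintype.card V : ℝ) ^ 2 * Λ) :=
        mul_le_mul_of_nonneg_left (Finset.sum_le_sum fun A hA => Finset.sum_le_sum fun e _ =>
          mul_le_mul_of_nonneg_left (sum_worm_symmDiff_le G hx hn ((mem_worm G).1 hA).1)
            (hΦ0 A e)) (Nat.cast_nonneg _)
    _ = _ := by
        simp only [← Finset.sum_mul]
        ring

end Worm

/-! ### Stationary flow, detailed balance and laziness of the worm chain. -/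

namespace Worm

section

variable {V : Type*} [DecidableEq V]

theorem flipFactor_pos {x : ℝ} (hx : 0 < x) (A : Finset (Sym2 V)) (e : Sym2 V) :
    0 < flipFactor x A e := by
  rw [flipFactor]
  split_ifs <;> positivity

theorem le_flipFactor {x : ℝ} (hx : x ∈ Set.Ioo (0 : ℝ) 1) (A : Finset (Sym2 V)) (e : Sym2 V) :
    x ≤ flipFactor x A e := by
  rw [flipFactor]
  split_ifs
  · exact hx.2.le.trans (one_le_inv₀ hx.1 |>.2 hx.2.le)
  · exact le_rfl

theorem pow_mul_flipFactor {x : ℝ} (hx : 0 < x) (A : Finset (Sym2 V)) (e : Sym2 V) :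
    x ^ A.card * flipFactor x A e = x ^ (A ∆ {e}).card := by
  rw [flipFactor]
  split_ifs with h
  · have : insert e (A ∆ {e}) = A := by
      ext a
      by_cases ha : a = e <;> simp [Finset.mem_symmDiff, ha, h]
    have hne : e ∉ A ∆ {e} := by simp [Finset.mem_symmDiff, h]
    have hc := Finset.card_insert_of_notMem hne
    rw [this] at hc
    rw [hc, pow_succ, mul_assoc, mul_inv_cancel₀ hx.ne', mul_one]
  · have : A ∆ {e} = insert e A := by
      ext a
      by_cases ha : a = e <;> simp [Finset.mem_symmDiff, ha, h]
    rw [this, Finset.card_insert_of_notMem h, pow_succ]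

theorem pow_mul_min_flipFactor {x : ℝ} (hx : 0 < x) (A : Finset (Sym2 V)) (e : Sym2 V) :
    x ^ A.card * min 1 (flipFactor x A e) = min (x ^ A.card) (x ^ (A ∆ {e}).card) := by
  rw [mul_min_of_nonneg _ _ (pow_pos hx _).le, mul_one, pow_mul_flipFactor hx]

theorem symmDiff_singleton_ne (A : Finset (Sym2 V)) (e : Sym2 V) : A ≠ A ∆ {e} := by
  intro h
  have := congrArg (e ∈ ·) h
  simp [Finset.mem_symmDiff] at this

theorem flip_flip (A : Finset (Sym2 V)) (e : Sym2 V) : (A ∆ {e}) ∆ {e} = A :=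
  symmDiff_symmDiff_cancel_right _ _

end

section

variable {V : Type*} [Fintype V] (G : SimpleGraph V) [DecidableRel G.Adj]

theorem degree_cast_pos {u v : V} (h : G.Adj u v) : 0 < (G.degree u : ℝ) := by
  have : 0 < G.degree u := (G.degree_pos_iff_exists_adj u).2 ⟨v, h⟩
  exact_mod_cast this

theorem sum_neighbor_symm (F : V → V → ℝ) :
    ∑ u, ∑ v ∈ G.neighborFinset u, F u v =
      1 / 2 * ∑ u, ∑ v ∈ G.neighborFinset u, (F u v + F v u) := by
  have h : ∑ u, ∑ v ∈ G.neighborFinset u, F v u = ∑ u, ∑ v ∈ G.neighborFinset u, F u v := by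
    refine Finset.sum_comm' fun u v => ?_
    simp [G.adj_comm]
  simp only [Finset.sum_add_distrib, h]
  ring

end

variable {V : Type*} [Fintype V] [DecidableEq V] (G : SimpleGraph V) [DecidableRel G.Adj]

theorem notMem_config_two {A : Finset (Sym2 V)} (h : A ∈ config G 0) : A ∉ config G 2 :=
  fun h' => by
    rw [mem_config] at h h'
    omega

theorem startSet_of_zero {A : Finset (Sym2 V)} (h : A ∈ config G 0) :
    startSet G A = Finset.univ := if_pos h

theorem startSet_of_two {A : Finset (Sym2 V)} (h : A ∈ config G 2) :
    startSet G A = boundary A := if_neg fun h' => notMem_config_two G h' h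

/-- The factors `n` and `2` are exactly what cancels the uniform choice of `u`, so the flow retains
only `x ^ |A|`, the acceptance and `1 / d(u)`. -/
theorem weight_eq (x : ℝ) (A : State G) :
    weight G x A = x ^ A.1.card * ((startSet G A.1).card : ℝ) := by
  rw [weight]
  rcases Finset.mem_union.1 A.2 with h | h
  · rw [if_pos h, startSet_of_zero G h, Finset.card_univ]
  · rw [if_neg fun h' => notMem_config_two G h' h, startSet_of_two G h, ((mem_config G).1 h).2]
    norm_num

theorem weight_pos {x : ℝ} (hx : 0 < x) (hn : 1 ≤ Fintype.card V) (A : State G) :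
    0 < weight G x A := by
  have hn' : (0 : ℝ) < Fintype.card V := by exact_mod_cast hn
  rw [weight]
  split_ifs <;> positivity

theorem sum_weight_pos {x : ℝ} (hx : 0 < x) (hn : 1 ≤ Fintype.card V) :
    0 < ∑ B : State G, weight G x B :=
  Finset.sum_pos (fun B _ => weight_pos G hx hn B)
    ⟨⟨∅, Finset.mem_union_left _ (empty_mem_config_zero G)⟩, Finset.mem_univ _⟩

theorem startSet_card_pos {x : ℝ} (hx : 0 < x) (hn : 1 ≤ Fintype.card V) (A : State G) :
    (0 : ℝ) < (startSet G A.1).card := by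
  have := weight_pos G hx hn A
  rw [weight_eq] at this
  exact pos_of_mul_pos_right this (pow_pos hx _).le

theorem accept_nonneg {x : ℝ} (hx : 0 < x) (A : Finset (Sym2 V)) (u v : V) :
    0 ≤ accept G x A u v := by
  have := flipFactor_pos hx A s(u, v)
  rw [accept]
  split_ifs <;> positivity

theorem accept_le (x : ℝ) (A : Finset (Sym2 V)) (u v : V) : accept G x A u v ≤ 1 / 2 := by
  rw [accept]
  split_ifs
  · linarith [min_le_left 1 ((G.degree u : ℝ) / (G.degree v : ℝ) * flipFactor x A s(u, v))]
  · linarith [min_le_left 1 (flipFactor x A s(u, v))]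

/-- The unnormalized stationary flow through the flip of `uv` at `A` with `u` drawn first. -/
noncomputable def flow (x : ℝ) (A : Finset (Sym2 V)) (u v : V) : ℝ :=
  if u ∈ startSet G A then x ^ A.card * (accept G x A u v / (G.degree u : ℝ)) else 0

theorem flow_nonneg {x : ℝ} (hx : 0 < x) (A : Finset (Sym2 V)) (u v : V) :
    0 ≤ flow G x A u v := by
  have := accept_nonneg G hx A u v
  rw [flow]
  split_ifs <;> positivity

theorem weight_mul_transition {x : ℝ} (hx : 0 < x) (hn : 1 ≤ Fintype.card V) {A B : State G}
    (hAB : A ≠ B) : weight G x A * transition G x A B =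
      ∑ u, ∑ v ∈ G.neighborFinset u, if B.1 = A.1 ∆ {s(u, v)} then flow G x A.1 u v else 0 := by
  have hs := (startSet_card_pos G hx hn A).ne'
  rw [weight_eq, transition, ← Finset.sum_filter_add_sum_filter_not Finset.univ
    (fun u => u ∈ startSet G A.1) (fun u => ∑ v ∈ G.neighborFinset u, _)]
  have h0 : ∑ u with u ∉ startSet G A.1, ∑ v ∈ G.neighborFinset u,
      (if B.1 = A.1 ∆ {s(u, v)} then flow G x A.1 u v else 0) = 0 :=
    Finset.sum_eq_zero fun u hu => Finset.sum_eq_zero fun v _ => by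
      rw [flow, if_neg (Finset.mem_filter.1 hu).2, ite_self]
  rw [h0, add_zero, Finset.filter_univ_mem, ← Finset.mul_sum]
  rw [mul_assoc, ← mul_assoc ((startSet G A.1).card : ℝ), mul_one_div_cancel hs, one_mul,
    Finset.mul_sum]
  refine Finset.sum_congr rfl fun u hu => ?_
  rw [Finset.mul_sum]
  refine Finset.sum_congr rfl fun v _ => ?_
  rw [if_neg hAB.symm, add_zero, flow, if_pos hu]
  split_ifs <;> ring

theorem boundary_flip (A : Finset (Sym2 V)) (u v : V) :
    boundary (A ∆ {s(u, v)}) = boundary A ∆ {u, v} := by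
  rw [boundary_symmDiff, boundary_singleton]

theorem flip_zero {A : Finset (Sym2 V)} {u v : V} (hA : A ∈ config G 0) (huv : G.Adj u v) :
    A ∆ {s(u, v)} ∈ config G 2 ∧ boundary (A ∆ {s(u, v)}) = {u, v} := by
  rw [mem_config_zero] at hA
  have hb : boundary (A ∆ {s(u, v)}) = {u, v} := by
    rw [boundary_flip, hA.2, ← Finset.bot_eq_empty, bot_symmDiff]
  refine ⟨(mem_config G).2 ⟨symmDiff_subset_edgeFinset G hA.1 ?_, ?_⟩, hb⟩
  · rwa [Finset.singleton_subset_iff, SimpleGraph.mem_edgeFinset, SimpleGraph.mem_edgeSet]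
  · rw [hb, Finset.card_pair huv.ne]

theorem flow_zero {x : ℝ} (hx : 0 < x) {A : Finset (Sym2 V)} {u v : V} (hA : A ∈ config G 0) :
    flow G x A u v =
      1 / 2 * min (x ^ A.card) (x ^ (A ∆ {s(u, v)}).card) / (G.degree u : ℝ) := by
  rw [flow, startSet_of_zero G hA, if_pos (Finset.mem_univ u), accept,
    if_neg fun h => notMem_config_two G hA h.1, ← pow_mul_min_flipFactor hx]
  ring

theorem flow_two_zero {x : ℝ} (hx : 0 < x) {A : Finset (Sym2 V)} {u v : V}
    (hA : A ∈ config G 2) (hB : A ∆ {s(u, v)} ∈ config G 0) (hu : u ∈ boundary A) :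
    flow G x A u v =
      1 / 2 * min (x ^ A.card) (x ^ (A ∆ {s(u, v)}).card) / (G.degree u : ℝ) := by
  rw [flow, startSet_of_two G hA, if_pos hu, accept,
    if_neg fun h => notMem_config_two G hB h.2.1, ← pow_mul_min_flipFactor hx]
  ring

/-- The degree ratio in the acceptance makes this expression invariant under exchanging `A` with its
flip together with `u` and `v`. -/
theorem flow_two_two {x : ℝ} (hx : 0 < x) {A : Finset (Sym2 V)} {u v : V}
    (hd : 0 < (G.degree u : ℝ)) (hA : A ∈ config G 2) (hB : A ∆ {s(u, v)} ∈ config G 2)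
    (hu : u ∈ boundary A) : flow G x A u v =
      1 / 2 * min (x ^ A.card / (G.degree u : ℝ))
        (x ^ (A ∆ {s(u, v)}).card / (G.degree v : ℝ)) := by
  rw [flow, startSet_of_two G hA, if_pos hu, accept, if_pos ⟨hA, hB, hu⟩,
    ← pow_mul_flipFactor hx]
  have h : 0 ≤ x ^ A.card / (G.degree u : ℝ) := by positivity
  have h1 := mul_min_of_nonneg 1
    ((G.degree u : ℝ) / (G.degree v : ℝ) * flipFactor x A s(u, v)) h
  rw [mul_one] at h1
  have h2 : x ^ A.card / (G.degree u : ℝ) *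
      ((G.degree u : ℝ) / (G.degree v : ℝ) * flipFactor x A s(u, v)) =
      x ^ A.card * flipFactor x A s(u, v) / (G.degree v : ℝ) := by
    field_simp
  rw [h2] at h1
  rw [← h1]
  ring

theorem flow_of_notMem {x : ℝ} {A : Finset (Sym2 V)} {u v : V} (hA : A ∈ config G 2)
    (hu : u ∉ boundary A) : flow G x A u v = 0 := by
  rw [flow, startSet_of_two G hA, if_neg hu]

/-- In a flip between two configurations with two odd vertices, exactly one endpoint of the edge
is odd. -/
theorem mem_boundary_flip {A : Finset (Sym2 V)} {u v : V} (huv : u ≠ v) (hA : A ∈ config G 2)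
    (hB : A ∆ {s(u, v)} ∈ config G 2) :
    (u ∈ boundary A ∧ v ∉ boundary A) ∨ (v ∈ boundary A ∧ u ∉ boundary A) := by
  have hA' := ((mem_config G).1 hA).2
  have hB' := ((mem_config G).1 hB).2
  rw [boundary_flip] at hB'
  by_cases hu : u ∈ boundary A
  · rcases card_symmDiff_pair hA' hu huv with h | h
    · omega
    · exact Or.inl ⟨hu, h.2⟩
  · by_cases hv : v ∈ boundary A
    · exact Or.inr ⟨hv, hu⟩
    · exfalso
      have hd : Disjoint (boundary A) {u, v} := by
        rw [Finset.disjoint_left]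
        intro w hw hw'
        rcases Finset.mem_insert.1 hw' with rfl | h
        · exact hu hw
        · rw [Finset.mem_singleton] at h
          exact hv (h ▸ hw)
      rw [hd.symmDiff_eq_sup, Finset.sup_eq_union, Finset.card_union_of_disjoint hd,
        Finset.card_pair huv] at hB'
      omega

theorem boundary_of_flip_zero {A : Finset (Sym2 V)} {u v : V} (huv : G.Adj u v)
    (hB : A ∆ {s(u, v)} ∈ config G 0) : A ∈ config G 2 ∧ boundary A = {u, v} := by
  have := flip_zero G hB huv
  rwa [flip_flip] at this

theorem flow_symm_zero {x : ℝ} (hx : 0 < x) {A : Finset (Sym2 V)} {u v : V} (huv : G.Adj u v)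
    (hA : A ∈ config G 0) : flow G x A u v + flow G x A v u =
      flow G x (A ∆ {s(u, v)}) u v + flow G x (A ∆ {s(u, v)}) v u := by
  obtain ⟨hB, hb⟩ := flip_zero G hA huv
  have e := flip_flip A s(u, v)
  have hswap : s(v, u) = s(u, v) := Sym2.eq_swap
  rw [flow_zero G hx hA, flow_zero G hx hA,
    flow_two_zero G hx hB (by rwa [e]) (by simp [hb]),
    flow_two_zero G hx hB (by rwa [hswap, e]) (by simp [hb]), hswap, e,
    min_comm (x ^ (A ∆ {s(u, v)}).card)]

theorem flow_symm_two {x : ℝ} (hx : 0 < x) {A : Finset (Sym2 V)} {u v : V} (huv : G.Adj u v)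
    (hA : A ∈ config G 2) (hB : A ∆ {s(u, v)} ∈ config G 2) (hu : u ∈ boundary A)
    (hv : v ∉ boundary A) : flow G x A u v + flow G x A v u =
      flow G x (A ∆ {s(u, v)}) u v + flow G x (A ∆ {s(u, v)}) v u := by
  have e := flip_flip A s(u, v)
  have hswap : s(v, u) = s(u, v) := Sym2.eq_swap
  have hu' : u ∉ boundary (A ∆ {s(u, v)}) := by
    rw [boundary_flip]
    simp [Finset.mem_symmDiff, hu]
  have hv' : v ∈ boundary (A ∆ {s(u, v)}) := by
    rw [boundary_flip]
    simp [Finset.mem_symmDiff, hv]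
  rw [flow_of_notMem G hA hv, flow_of_notMem G hB hu',
    flow_two_two G hx (degree_cast_pos G huv) hA hB hu,
    flow_two_two G hx (degree_cast_pos G huv.symm) hB (by rwa [hswap, e]) hv', hswap, e,
    min_comm, add_zero, zero_add]

/-- Only the sum over both orders of drawing the edge is balanced: within `C_2` a move that draws
`u` first is reversed by drawing `v` first. -/
theorem flow_symm {x : ℝ} (hx : 0 < x) {A : Finset (Sym2 V)} {u v : V} (huv : G.Adj u v)
    (hA : A ∈ config G 0 ∪ config G 2) (hB : A ∆ {s(u, v)} ∈ config G 0 ∪ config G 2) :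
    flow G x A u v + flow G x A v u =
      flow G x (A ∆ {s(u, v)}) u v + flow G x (A ∆ {s(u, v)}) v u := by
  rcases Finset.mem_union.1 hA with hA | hA
  · exact flow_symm_zero G hx huv hA
  rcases Finset.mem_union.1 hB with hB | hB
  · have := flow_symm_zero G hx huv hB
    rw [flip_flip] at this
    exact this.symm
  rcases mem_boundary_flip G huv.ne hA hB with ⟨hu, hv⟩ | ⟨hv, hu⟩
  · exact flow_symm_two G hx huv hA hB hu hv
  · have hswap : s(v, u) = s(u, v) := Sym2.eq_swap
    have := flow_symm_two G hx huv.symm hA (by rwa [hswap]) hv hu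
    rw [hswap] at this
    linarith

/-- Detailed balance. -/
theorem reversible {x : ℝ} (hx : 0 < x) (hn : 1 ≤ Fintype.card V) (A B : State G) :
    weight G x A * transition G x A B = weight G x B * transition G x B A := by
  by_cases hAB : A = B
  · rw [hAB]
  rw [weight_mul_transition G hx hn hAB, weight_mul_transition G hx hn (Ne.symm hAB),
    sum_neighbor_symm, sum_neighbor_symm G fun u v => ite (A.1 = _) _ _]
  congr 1
  refine Finset.sum_congr rfl fun u _ => Finset.sum_congr rfl fun v hv => ?_
  have huv : G.Adj u v := by simpa using hv
  have hswap : s(v, u) = s(u, v) := Sym2.eq_swap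
  rw [hswap]
  have hiff : B.1 = A.1 ∆ {s(u, v)} ↔ A.1 = B.1 ∆ {s(u, v)} :=
    ⟨fun h => by rw [h, flip_flip], fun h => by rw [h, flip_flip]⟩
  by_cases h : B.1 = A.1 ∆ {s(u, v)}
  · simp only [if_pos h, if_pos (hiff.1 h)]
    have := flow_symm G hx huv A.2 (h ▸ B.2)
    rwa [← h] at this
  · simp only [if_neg h, if_neg (fun h' => h (hiff.2 h'))]

theorem flip_mem_worm {A : Finset (Sym2 V)} (hA : A ∈ config G 0 ∪ config G 2) {u v : V}
    (huv : G.Adj u v) (hu : u ∈ startSet G A) :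
    A ∆ {s(u, v)} ∈ config G 0 ∪ config G 2 := by
  rcases Finset.mem_union.1 hA with h | h
  · exact Finset.mem_union_right _ (flip_zero G h huv).1
  · rw [startSet_of_two G h] at hu
    rw [mem_config] at h
    rw [mem_worm, boundary_flip]
    refine ⟨symmDiff_subset_edgeFinset G h.1 ?_, ?_⟩
    · rwa [Finset.singleton_subset_iff, SimpleGraph.mem_edgeFinset, SimpleGraph.mem_edgeSet]
    · rcases card_symmDiff_pair h.2 hu huv.ne with h' | h'
      · exact Or.inl h'.1
      · exact Or.inr h'.1

theorem sum_average {ι : Type*} (s : Finset ι) {k : ℝ} (hk : (s.card : ℝ) = k) (h0 : k ≠ 0)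
    (c : ℝ) : ∑ _i ∈ s, 1 / k * c = c := by
  rw [Finset.sum_const, nsmul_eq_mul, hk]
  field_simp

theorem transition_nonneg {x : ℝ} (hx : 0 < x) (A B : State G) : 0 ≤ transition G x A B := by
  rw [transition]
  refine Finset.sum_nonneg fun u _ => mul_nonneg (by positivity)
    (Finset.sum_nonneg fun v _ => mul_nonneg (by positivity) (add_nonneg ?_ ?_))
  · split_ifs
    · exact accept_nonneg G hx _ _ _
    · exact le_rfl
  · split_ifs
    · linarith [accept_le G x A.1 u v]
    · exact le_rfl

theorem transition_row_sum {x : ℝ} (hx : 0 < x) (hn : 1 ≤ Fintype.card V)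
    (hd : ∀ u, (G.degree u : ℝ) ≠ 0) (A : State G) : ∑ B, transition G x A B = 1 := by
  simp only [transition]
  rw [Finset.sum_comm]
  have h1 : ∀ u ∈ startSet G A.1, ∑ B : State G, (1 / ((startSet G A.1).card : ℝ)) *
      ∑ v ∈ G.neighborFinset u, (1 / (G.degree u : ℝ)) *
        ((if B.1 = A.1 ∆ {s(u, v)} then accept G x A.1 u v else 0) +
          (if B = A then 1 - accept G x A.1 u v else 0)) =
      1 / ((startSet G A.1).card : ℝ) * 1 := fun u hu => by
    rw [← Finset.mul_sum, Finset.sum_comm]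
    congr 1
    refine Eq.trans ?_ (sum_average (G.neighborFinset u)
      (by rw [SimpleGraph.card_neighborFinset_eq_degree]) (hd u) 1)
    refine Finset.sum_congr rfl fun v hv => ?_
    rw [← Finset.mul_sum, Finset.sum_add_distrib]
    congr 1
    have hmem := flip_mem_worm G A.2 (by simpa using hv) hu
    have h2 : ∀ B : State G, B.1 = A.1 ∆ {s(u, v)} ↔ B = ⟨A.1 ∆ {s(u, v)}, hmem⟩ := fun B =>
      ⟨fun h => Subtype.ext h, fun h => congrArg Subtype.val h⟩
    simp only [h2, Finset.sum_ite_eq', Finset.mem_univ, if_true]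
    ring
  rw [Finset.sum_congr rfl h1]
  exact sum_average _ rfl (startSet_card_pos G hx hn A).ne' 1

theorem transition_lazy {x : ℝ} (hx : 0 < x) (hn : 1 ≤ Fintype.card V)
    (hd : ∀ u, (G.degree u : ℝ) ≠ 0) (A : State G) : 1 / 2 ≤ transition G x A A := by
  rw [transition, ← sum_average (startSet G A.1) rfl (startSet_card_pos G hx hn A).ne' (1 / 2)]
  refine Finset.sum_le_sum fun u _ => mul_le_mul_of_nonneg_left ?_ (by positivity)
  rw [← sum_average (G.neighborFinset u) (by rw [SimpleGraph.card_neighborFinset_eq_degree])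
    (hd u) (1 / 2)]
  refine Finset.sum_le_sum fun v _ => mul_le_mul_of_nonneg_left ?_ (by positivity)
  rw [if_neg (symmDiff_singleton_ne _ _), if_pos rfl]
  linarith [accept_le G x A.1 u v]

theorem isLazyStationary {x : ℝ} (hx : 0 < x) (hn : 1 ≤ Fintype.card V)
    (hd : ∀ u, (G.degree u : ℝ) ≠ 0) :
    MarkovMixing.IsLazyStationary (transition G x) (stationary G x) := by
  have hZ := sum_weight_pos G hx hn
  refine ⟨transition_nonneg G hx, transition_row_sum G hx hn hd, transition_lazy G hx hn hd,
    fun A => div_nonneg (weight_pos G hx hn A).le hZ.le, ?_, fun B => ?_⟩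
  · simp only [stationary]
    rw [← Finset.sum_div, div_self hZ.ne']
  · simp only [stationary, div_mul_eq_mul_div, reversible G hx hn _ B]
    rw [← Finset.sum_div, ← Finset.mul_sum, transition_row_sum G hx hn hd, mul_one]

/-! ### Lower bounds on the flow and the Poincaré inequality. -/

theorem exists_flow_lower_bound {x : ℝ} (hx : x ∈ Set.Ioo (0 : ℝ) 1) {A : Finset (Sym2 V)}
    {e : Sym2 V} (he : e ∈ G.edgeFinset) (hA : A ∈ config G 0 ∪ config G 2)
    (hB : A ∆ {e} ∈ config G 0 ∪ config G 2) :
    ∃ u v, G.Adj u v ∧ e = s(u, v) ∧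
      x ^ A.card * x / (2 * (G.maxDegree : ℝ)) ≤ flow G x A u v := by
  have hdeg : ∀ u, (G.degree u : ℝ) ≤ G.maxDegree := fun u => by
    exact_mod_cast G.degree_le_maxDegree u
  have hlow : x ^ A.card * x ≤ x ^ A.card :=
    mul_le_of_le_one_right (pow_pos hx.1 _).le hx.2.le
  have hlow' : x ^ A.card * x ≤ x ^ (A ∆ {e}).card := by
    rw [← pow_mul_flipFactor hx.1]
    exact mul_le_mul_of_nonneg_left (le_flipFactor hx A e) (pow_pos hx.1 _).le
  have hnn : 0 ≤ x ^ A.card * x := mul_nonneg (pow_pos hx.1 _).le hx.1.le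
  have hdiv : ∀ {y : ℝ} {u v : V}, G.Adj u v → x ^ A.card * x ≤ y →
      x ^ A.card * x / (G.maxDegree : ℝ) ≤ y / (G.degree u : ℝ) := fun {y u v} h hy =>
    div_le_div₀ (hnn.trans hy) hy (degree_cast_pos G h) (hdeg u)
  have hhalf : x ^ A.card * x / (2 * (G.maxDegree : ℝ)) =
      1 / 2 * (x ^ A.card * x / (G.maxDegree : ℝ)) := by
    rw [mul_comm (2 : ℝ), ← div_div]
    ring
  rw [hhalf]
  induction e using Sym2.ind with
  | _ u v =>
    have huv : G.Adj u v := by simpa using he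
    rcases Finset.mem_union.1 hA with hA | hA
    · refine ⟨u, v, huv, rfl, ?_⟩
      rw [flow_zero G hx.1 hA, mul_div_assoc (1 / 2 : ℝ)]
      exact mul_le_mul_of_nonneg_left (hdiv huv (le_min hlow hlow')) one_half_pos.le
    rcases Finset.mem_union.1 hB with hB | hB
    · refine ⟨u, v, huv, rfl, ?_⟩
      rw [flow_two_zero G hx.1 hA hB (by simp [(boundary_of_flip_zero G huv hB).2]),
        mul_div_assoc (1 / 2 : ℝ)]
      exact mul_le_mul_of_nonneg_left (hdiv huv (le_min hlow hlow')) one_half_pos.le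
    rcases mem_boundary_flip G huv.ne hA hB with ⟨hu, -⟩ | ⟨hv, -⟩
    · refine ⟨u, v, huv, rfl, ?_⟩
      rw [flow_two_two G hx.1 (degree_cast_pos G huv) hA hB hu]
      exact mul_le_mul_of_nonneg_left (le_min (hdiv huv hlow) (hdiv huv.symm hlow'))
        (by norm_num)
    · have hswap : s(u, v) = s(v, u) := Sym2.eq_swap
      refine ⟨v, u, huv.symm, hswap, ?_⟩
      rw [hswap] at hB hlow'
      rw [flow_two_two G hx.1 (degree_cast_pos G huv.symm) hA hB hv]
      exact mul_le_mul_of_nonneg_left (le_min (hdiv huv.symm hlow) (hdiv huv hlow'))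
        (by norm_num)

theorem weight_mul_transition_ge {x : ℝ} (hx : x ∈ Set.Ioo (0 : ℝ) 1) (hn : 1 ≤ Fintype.card V)
    {A B : State G} {e : Sym2 V} (he : e ∈ G.edgeFinset) (hB : B.1 = A.1 ∆ {e}) :
    x ^ A.1.card * x / (2 * (G.maxDegree : ℝ)) ≤ weight G x A * transition G x A B := by
  have hAB : A ≠ B := fun h => symmDiff_singleton_ne A.1 e (by rw [← hB, h])
  obtain ⟨u, v, huv, rfl, hle⟩ := exists_flow_lower_bound G hx he A.2 (hB ▸ B.2)
  rw [weight_mul_transition G hx.1 hn hAB]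
  refine hle.trans ?_
  have hnn : ∀ u v, 0 ≤ if B.1 = A.1 ∆ {s(u, v)} then flow G x A.1 u v else 0 := fun u v => by
    split_ifs
    · exact flow_nonneg G hx.1 _ _ _
    · exact le_rfl
  calc flow G x A.1 u v = if B.1 = A.1 ∆ {s(u, v)} then flow G x A.1 u v else 0 := by
        rw [if_pos hB]
    _ ≤ ∑ w ∈ G.neighborFinset u, if B.1 = A.1 ∆ {s(u, w)} then flow G x A.1 u w else 0 :=
        Finset.single_le_sum
          (f := fun w => if B.1 = A.1 ∆ {s(u, w)} then flow G x A.1 u w else 0)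
          (fun w _ => hnn u w) (by simpa using huv)
    _ ≤ _ := Finset.single_le_sum (f := fun u => ∑ w ∈ G.neighborFinset u,
          if B.1 = A.1 ∆ {s(u, w)} then flow G x A.1 u w else 0)
          (fun u _ => Finset.sum_nonneg fun w _ => hnn u w) (Finset.mem_univ u)

theorem weight_le {x : ℝ} (hx : 0 < x) (hn : 2 ≤ Fintype.card V) (A : State G) :
    weight G x A ≤ x ^ A.1.card * (Fintype.card V : ℝ) := by
  have hn' : (2 : ℝ) ≤ Fintype.card V := by exact_mod_cast hn
  rw [weight]
  refine mul_le_mul_of_nonneg_left ?_ (pow_pos hx _).le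
  split_ifs
  · exact le_rfl
  · exact hn'

theorem le_weight {x : ℝ} (hx : 0 < x) (hn : 2 ≤ Fintype.card V) (A : State G) :
    x ^ A.1.card ≤ weight G x A := by
  have hn' : (2 : ℝ) ≤ Fintype.card V := by exact_mod_cast hn
  rw [weight]
  refine le_mul_of_one_le_right (pow_pos hx _).le ?_
  split_ifs <;> linarith

/-- Flips of single edges, compared with the transitions of the worm chain. -/
theorem sum_flip_sq_le {x : ℝ} (hx : x ∈ Set.Ioo (0 : ℝ) 1) (hn : 1 ≤ Fintype.card V)
    (hΔ : 0 < (G.maxDegree : ℝ)) (g : Finset (Sym2 V) → ℝ) :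
    ∑ A ∈ config G 0 ∪ config G 2, ∑ e ∈ G.edgeFinset,
        (if A ∆ {e} ∈ config G 0 ∪ config G 2 then
          x ^ A.card * (g A - g (A ∆ {e})) ^ 2 else 0) ≤
      2 * (G.maxDegree : ℝ) / x *
        ∑ A : State G, ∑ B : State G,
          weight G x A * transition G x A B * (g A.1 - g B.1) ^ 2 := by
  rw [← Finset.sum_coe_sort, Finset.mul_sum]
  refine Finset.sum_le_sum fun A _ => ?_
  set k := 2 * (G.maxDegree : ℝ) / x with hk
  have hk0 : 0 < k := div_pos (by positivity) hx.1
  set K : State G → ℝ := fun B =>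
    k * (weight G x A * transition G x A B * (g A.1 - g B.1) ^ 2) with hK
  have hK0 : ∀ B, 0 ≤ K B := fun B => mul_nonneg hk0.le (mul_nonneg
    (mul_nonneg (weight_pos G hx.1 hn A).le (transition_nonneg G hx.1 A B)) (sq_nonneg _))
  calc ∑ e ∈ G.edgeFinset, (if A.1 ∆ {e} ∈ config G 0 ∪ config G 2 then
          x ^ A.1.card * (g A.1 - g (A.1 ∆ {e})) ^ 2 else 0)
      ≤ ∑ e ∈ G.edgeFinset, ∑ B : State G, if B.1 = A.1 ∆ {e} then K B else 0 := by
        refine Finset.sum_le_sum fun e he => ?_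
        have hnn : ∀ B : State G, 0 ≤ if B.1 = A.1 ∆ {e} then K B else 0 := fun B => by
          split_ifs
          · exact hK0 B
          · exact le_rfl
        split_ifs with h
        · refine le_trans ?_ (Finset.single_le_sum (fun B _ => hnn B)
            (Finset.mem_univ (⟨A.1 ∆ {e}, h⟩ : State G)))
          rw [if_pos rfl]
          have h1 := weight_mul_transition_ge G hx hn (A := A) (B := ⟨A.1 ∆ {e}, h⟩) he rfl
          have h2 : x ^ A.1.card ≤ k * (weight G x A * transition G x A ⟨A.1 ∆ {e}, h⟩) := by
            refine le_trans (le_of_eq ?_) (mul_le_mul_of_nonneg_left h1 hk0.le)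
            have := hx.1.ne'
            rw [hk]
            field_simp
          rw [hK]
          simp only
          rw [← mul_assoc]
          exact mul_le_mul_of_nonneg_right h2 (sq_nonneg _)
        · exact Finset.sum_nonneg fun B _ => hnn B
    _ = ∑ B : State G, ∑ e ∈ G.edgeFinset, if B.1 = A.1 ∆ {e} then K B else 0 :=
        Finset.sum_comm
    _ ≤ ∑ B : State G, K B := by
        refine Finset.sum_le_sum fun B _ => ?_
        rw [← Finset.sum_filter, Finset.sum_const, nsmul_eq_mul]
        refine mul_le_of_le_one_left (hK0 B) ?_
        -- Two states differ by at most one single-edge flip, so no transition is counted twice.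
        have : (G.edgeFinset.filter fun e => B.1 = A.1 ∆ {e}).card ≤ 1 :=
          Finset.card_le_one.2 fun e he e' he' => by
            have h1 := (Finset.mem_filter.1 he).2
            rw [(Finset.mem_filter.1 he').2] at h1
            exact (Finset.singleton_injective (symmDiff_right_injective A.1 h1)).symm
        exact_mod_cast this
    _ = _ := by rw [Finset.mul_sum]

theorem dirichlet_stationary (x : ℝ) (f : State G → ℝ) :
    MarkovMixing.dirichlet (transition G x) (stationary G x) f =
      1 / 2 * ((∑ A, ∑ B, weight G x A * transition G x A B * (f A - f B) ^ 2) /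
        ∑ B : State G, weight G x B) := by
  rw [MarkovMixing.dirichlet]
  simp only [stationary, Finset.sum_div, div_mul_eq_mul_div]

/-- The mean minimizes the second moment; the freedom in `c` allows centring at the `C_0`-average.
-/
theorem sum_stationary_sq_le {x : ℝ} (hx : 0 < x) (hn : 1 ≤ Fintype.card V) (f : State G → ℝ)
    (hf : ∑ A, stationary G x A * f A = 0) (c : ℝ) :
    ∑ A, stationary G x A * f A ^ 2 ≤
      (∑ A, weight G x A * (f A - c) ^ 2) / ∑ B : State G, weight G x B := by
  have h1 : ∑ A, stationary G x A = 1 := by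
    simp only [stationary]
    rw [← Finset.sum_div, div_self (sum_weight_pos G hx hn).ne']
  have h2 : (∑ A, weight G x A * (f A - c) ^ 2) / ∑ B : State G, weight G x B =
      ∑ A, stationary G x A * f A ^ 2 - 2 * c * ∑ A, stationary G x A * f A
        + c ^ 2 * ∑ A, stationary G x A := by
    rw [Finset.sum_div]
    simp only [Finset.mul_sum, ← Finset.sum_add_distrib, ← Finset.sum_sub_distrib]
    exact Finset.sum_congr rfl fun A _ => by rw [stationary]; ring
  rw [h2, hf, h1]
  nlinarith [sq_nonneg c]

/-- The Poincaré inequality of the worm chain. -/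
theorem poincare {x : ℝ} (hx : x ∈ Set.Ioo (0 : ℝ) 1) (hn : 2 ≤ Fintype.card V)
    (hΔ : 0 < (G.maxDegree : ℝ)) (f : State G → ℝ) (hf : ∑ A, stationary G x A * f A = 0) :
    ∑ A, stationary G x A * f A ^ 2 ≤
      4 * (G.maxDegree : ℝ) * (Fintype.card V : ℝ) ^ 3 * (G.edgeFinset.card : ℝ) / x *
        MarkovMixing.dirichlet (transition G x) (stationary G x) f := by
  have hn1 : 1 ≤ Fintype.card V := by omega
  set n : ℝ := (Fintype.card V : ℝ) with hn'
  set m : ℝ := (G.edgeFinset.card : ℝ) with hm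
  have hn0 : 0 ≤ n := Nat.cast_nonneg _
  set W := config G 0 ∪ config G 2 with hW
  set Z := ∑ B : State G, weight G x B with hZdef
  have hZ : 0 < Z := sum_weight_pos G hx.1 hn1
  set Λ := ∑ B ∈ config G 0, x ^ B.card with hΛdef
  have hΛ : 0 < Λ := Finset.sum_pos (fun B _ => pow_pos hx.1 _) ⟨∅, empty_mem_config_zero G⟩
  set g : Finset (Sym2 V) → ℝ := fun A => if h : A ∈ W then f ⟨A, h⟩ else 0 with hg
  have hgf : ∀ A : State G, g A.1 = f A := fun A => dif_pos A.2
  set c := (∑ F ∈ config G 0, x ^ F.card * g F) / Λ with hc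
  set Q := ∑ A : State G, ∑ B : State G,
    weight G x A * transition G x A B * (f A - f B) ^ 2 with hQ
  have hdir : MarkovMixing.dirichlet (transition G x) (stationary G x) f = 1 / 2 * (Q / Z) :=
    dirichlet_stationary G x f
  have hcenter : ∑ A, stationary G x A * f A ^ 2 ≤ (∑ A, weight G x A * (f A - c) ^ 2) / Z :=
    sum_stationary_sq_le G hx.1 hn1 f hf c
  -- Jensen for the average over `C_0` reduces the variance to pairs with one member in `C_0`, the
  -- only pairs joined by the canonical paths.
  have hjensen : ∀ I, (g I - c) ^ 2 ≤
      (∑ F ∈ config G 0, x ^ F.card * (g I - g F) ^ 2) / Λ := fun I => by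
    have h1 : g I - c = (∑ F ∈ config G 0, x ^ F.card * (g I - g F)) / Λ := by
      simp only [mul_sub, Finset.sum_sub_distrib, ← Finset.sum_mul]
      rw [sub_div, hc, ← hΛdef, mul_div_cancel_left₀ _ hΛ.ne']
    have h2 := Finset.sum_sq_le_sum_mul_sum_of_sq_le_mul (config G 0)
      (r := fun F => x ^ F.card * (g I - g F)) (f := fun F => x ^ F.card)
      (g := fun F => x ^ F.card * (g I - g F) ^ 2) (fun F _ => (pow_pos hx.1 _).le)
      (fun F _ => mul_nonneg (pow_pos hx.1 _).le (sq_nonneg _)) (fun F _ => le_of_eq (by ring))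
    rw [h1, div_pow, div_le_div_iff₀ (pow_pos hΛ 2) hΛ]
    calc _ ≤ (Λ * ∑ F ∈ config G 0, x ^ F.card * (g I - g F) ^ 2) * Λ :=
          mul_le_mul_of_nonneg_right h2 hΛ.le
      _ = _ := by ring
  have hvar : ∑ A, weight G x A * (f A - c) ^ 2 ≤
      n / Λ * ∑ I ∈ W, ∑ F ∈ config G 0, x ^ I.card * x ^ F.card * (g I - g F) ^ 2 := by
    rw [← Finset.sum_coe_sort W, Finset.mul_sum]
    refine Finset.sum_le_sum fun A _ => ?_
    rw [← hgf A]
    calc weight G x A * (g A.1 - c) ^ 2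
        ≤ (x ^ A.1.card * n) * ((∑ F ∈ config G 0, x ^ F.card * (g A.1 - g F) ^ 2) / Λ) :=
          mul_le_mul (weight_le G hx.1 hn A) (hjensen A.1) (sq_nonneg _)
            (mul_nonneg (pow_pos hx.1 _).le hn0)
      _ = _ := by
          simp only [mul_assoc, ← Finset.mul_sum]
          ring
  have hpair := sum_sq_sub_le G hx hn1 g
  have hflip := sum_flip_sq_le G hx hn1 hΔ g
  simp only [hgf] at hflip
  have hm0 : 0 ≤ m * (n ^ 2 * Λ) := mul_nonneg (Nat.cast_nonneg _) (by positivity)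
  have hall : ∑ A, weight G x A * (f A - c) ^ 2 ≤
      n / Λ * (m * (n ^ 2 * Λ) * (2 * (G.maxDegree : ℝ) / x * Q)) :=
    hvar.trans (mul_le_mul_of_nonneg_left
      (hpair.trans (mul_le_mul_of_nonneg_left hflip hm0)) (div_nonneg hn0 hΛ.le))
  refine hcenter.trans ?_
  rw [hdir, div_le_iff₀ hZ]
  refine hall.trans_eq ?_
  have := hx.1.ne'
  field_simp
  ring

/-! ### Minimal stationary mass and the final arithmetic. -/

/-- Each weight is at least `x ^ m`. The normalization is at most `4 ^ m`: there are at most `2 ^ m`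
states, each of weight at most `n ≤ m + 1 ≤ 2 ^ m`, where connectedness gives the first inequality.
-/
theorem le_stationary {x : ℝ} (hx : x ∈ Set.Ioo (0 : ℝ) 1) (hG : G.Connected)
    (hn : 2 ≤ Fintype.card V) (A : State G) :
    (x / 4) ^ G.edgeFinset.card ≤ stationary G x A := by
  set m := G.edgeFinset.card with hm
  have hnm : (Fintype.card V : ℝ) ≤ 2 ^ m := by
    have h1 := hG.card_vert_le_card_edgeSet_add_one
    rw [Nat.card_eq_fintype_card, Nat.card_eq_fintype_card, ← SimpleGraph.edgeFinset_card] at h1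
    have h2 : m + 1 ≤ 2 ^ m := Nat.lt_two_pow_self
    exact_mod_cast h1.trans h2
  have hZ : ∑ B : State G, weight G x B ≤ 4 ^ m := by
    calc ∑ B : State G, weight G x B ≤ ∑ B : State G, (2 : ℝ) ^ m :=
          Finset.sum_le_sum fun B _ => (weight_le G hx.1 hn B).trans
            ((mul_le_of_le_one_left (Nat.cast_nonneg _)
              (pow_le_one₀ hx.1.le hx.2.le)).trans hnm)
      _ = (Fintype.card (State G) : ℝ) * 2 ^ m := by
          rw [Finset.sum_const, nsmul_eq_mul, Finset.card_univ]
      _ ≤ 2 ^ m * 2 ^ m := by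
          refine mul_le_mul_of_nonneg_right ?_ (by positivity)
          have : Fintype.card (State G) ≤ 2 ^ m := by
            rw [Fintype.card_coe, ← Finset.card_powerset]
            exact Finset.card_le_card fun A hA => Finset.mem_powerset.2 ((mem_worm G).1 hA).1
          exact_mod_cast this
      _ = 4 ^ m := by rw [← mul_pow]; norm_num
  have hA : x ^ m ≤ weight G x A :=
    (pow_le_pow_of_le_one hx.1.le hx.2.le
      (Finset.card_le_card ((mem_worm G).1 A.2).1)).trans (le_weight G hx.1 hn A)
  rw [div_pow, stationary]
  exact div_le_div₀ (weight_pos G hx.1 (by omega) A).le hA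
    (sum_weight_pos G hx.1 (by omega)) hZ

theorem one_sub_inv_pow_le {C δ p : ℝ} (hC : 1 ≤ C) (hδ : 0 < δ) (hp : 0 < p) {t : ℕ}
    (ht : C * (-Real.log p - 2 * Real.log δ) ≤ t) : (1 - 1 / C) ^ t ≤ δ ^ 2 * p := by
  have hC0 : 0 < C := by linarith
  have h0 : 0 ≤ 1 - 1 / C := by
    rw [sub_nonneg, div_le_one hC0]
    exact hC
  have h1 : 1 - 1 / C ≤ Real.exp (-(1 / C)) := by
    have := Real.add_one_le_exp (-(1 / C))
    linarith
  have h2 : -Real.log p - 2 * Real.log δ ≤ t / C := by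
    rw [le_div_iff₀ hC0]
    linarith
  calc (1 - 1 / C) ^ t ≤ Real.exp (-(1 / C)) ^ t := pow_le_pow_left₀ h0 h1 t
    _ = Real.exp (-(t / C)) := by
        rw [← Real.exp_nat_mul]
        congr 1
        ring
    _ ≤ Real.exp (Real.log (δ ^ 2 * p)) := by
        rw [Real.exp_le_exp, Real.log_mul (by positivity) hp.ne', Real.log_pow]
        push_cast
        linarith
    _ = δ ^ 2 * p := Real.exp_log (by positivity)

/-- The `+ 1` pays for rounding the time up to an integer. Both sides are compared with `3 C (m L +
ℓ)`, where `C` is the Poincaré constant, `L = log (8 / x)` and `ℓ = -log δ`. -/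
theorem mixing_bound_arith {n m d x δ : ℝ} (hn : 2 ≤ n) (hm : 1 ≤ m) (hd : 1 ≤ d)
    (hx : x ∈ Set.Ioo (0 : ℝ) 1) (hδ : δ ∈ Set.Ioo (0 : ℝ) 1) :
    4 * d * n ^ 3 * m / x * (-(m * Real.log (x / 4)) - 2 * Real.log δ) + 1 ≤
      1 / (2 * x) * (Real.log (8 / x) - Real.log δ / m) * (3 + 1 / (m * x)) * d * n ^ 6 *
        m ^ 2 := by
  obtain ⟨hx0, hx1⟩ := hx
  set ℓ := -Real.log δ with hℓ
  have hℓ0 : 0 < ℓ := neg_pos.2 (Real.log_neg hδ.1 hδ.2)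
  set L := Real.log (8 / x) with hL
  have hlog : -Real.log (x / 4) = L - Real.log 2 := by
    rw [hL, ← Real.log_inv, ← Real.log_div (by positivity) (by norm_num)]
    congr 1
    field_simp
    norm_num
  have hlog2 : 1 / 2 ≤ Real.log 2 := by linarith [Real.log_two_gt_d9]
  have hLL : 0 ≤ L - Real.log 2 := by
    rw [← hlog]
    exact neg_nonneg.2 (Real.log_nonpos (by positivity) (by linarith))
  have hn3 : 8 ≤ n ^ 3 := by
    calc (8 : ℝ) = 2 ^ 3 := by norm_num
      _ ≤ n ^ 3 := pow_le_pow_left₀ (by norm_num) hn 3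
  set C := 4 * d * n ^ 3 * m / x with hC
  have hC1 : 1 ≤ C := by
    rw [hC, le_div_iff₀ hx0]
    have h1 : 1 ≤ d * m := one_le_mul_of_one_le_of_one_le hd hm
    have h2 : 8 ≤ n ^ 3 * (d * m) := by nlinarith
    nlinarith
  have hm0 : 0 < m := by linarith
  have hS : 0 ≤ m * L + ℓ := by
    have : 0 ≤ m * L := mul_nonneg hm0.le (by linarith)
    linarith
  have hright : 3 * C * (m * L + ℓ) ≤
      1 / (2 * x) * (L - Real.log δ / m) * (3 + 1 / (m * x)) * d * n ^ 6 * m ^ 2 := by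
    have e1 : 1 / (2 * x) * (L - Real.log δ / m) * (3 + 1 / (m * x)) * d * n ^ 6 * m ^ 2 =
        (d * n ^ 3 * m / (2 * x) * (m * L + ℓ)) * (n ^ 3 * (3 + 1 / (m * x))) := by
      rw [hℓ]
      field_simp
      ring
    -- The factor `24` is covered by `3 n³`, as `n ≥ 2`.
    have e2 : 3 * C * (m * L + ℓ) = (d * n ^ 3 * m / (2 * x) * (m * L + ℓ)) * 24 := by
      rw [hC]
      ring
    rw [e1, e2]
    refine mul_le_mul_of_nonneg_left ?_ (mul_nonneg (by positivity) hS)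
    have : 0 ≤ 1 / (m * x) := by positivity
    nlinarith
  refine le_trans ?_ hright
  have h1 : -(m * Real.log (x / 4)) = m * (L - Real.log 2) := by
    rw [← hlog]
    ring
  rw [h1]
  have h2 : 0 ≤ C * (m * (L - Real.log 2)) := by positivity
  -- Replacing `log (4 / x)` by `L` leaves a surplus of `3 C m log 2 ≥ 3 / 2`, which absorbs the `+
  -- 1`.
  have h3 : 1 / 2 ≤ C * (m * Real.log 2) := by
    have : 1 / 2 ≤ m * Real.log 2 := by nlinarith
    nlinarith
  have h4 : 0 ≤ C * ℓ := by positivity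
  have h5 : Real.log δ = -ℓ := by rw [hℓ, neg_neg]
  rw [h5]
  nlinarith

end Worm

theorem theorem1 {V : Type*} [Fintype V] [DecidableEq V]
    (G : SimpleGraph V) [DecidableRel G.Adj] (hG : G.Connected) (hn : 2 ≤ Fintype.card V)
    (x : ℝ) (hx : x ∈ Set.Ioo (0 : ℝ) 1) (δ : ℝ) (hδ : δ ∈ Set.Ioo (0 : ℝ) 1) :
    ∃ t : ℕ,
      MarkovMixing.IsMixingTime (Worm.transition G x) (Worm.stationary G x) δ t ∧
      (t : ℝ) ≤ 1 / (2 * x)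
        * (Real.log (8 / x) - Real.log δ / (G.edgeFinset.card : ℝ))
        * (3 + 1 / ((G.edgeFinset.card : ℝ) * x))
        * (G.maxDegree : ℝ) * (Fintype.card V : ℝ) ^ 6 * (G.edgeFinset.card : ℝ) ^ 2 := by
  have : Nontrivial V := Fintype.one_lt_card_iff_nontrivial.1 hn
  have hdeg : ∀ u, 1 ≤ G.degree u := fun u => hG.preconnected.degree_pos_of_nontrivial u
  obtain ⟨u₀⟩ := hG.nonempty
  have hΔ : (1 : ℝ) ≤ G.maxDegree := by
    exact_mod_cast (hdeg u₀).trans (G.degree_le_maxDegree u₀)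
  have hm : (1 : ℝ) ≤ G.edgeFinset.card := by
    have h1 := hG.card_vert_le_card_edgeSet_add_one
    rw [Nat.card_eq_fintype_card, Nat.card_eq_fintype_card, ← SimpleGraph.edgeFinset_card] at h1
    exact_mod_cast (by omega : 1 ≤ G.edgeFinset.card)
  have hn' : (2 : ℝ) ≤ Fintype.card V := by exact_mod_cast hn
  have harith := Worm.mixing_bound_arith hn' hm hΔ hx hδ
  set C : ℝ := 4 * (G.maxDegree : ℝ) * (Fintype.card V : ℝ) ^ 3 * (G.edgeFinset.card : ℝ) / x
    with hC
  have hC1 : 1 ≤ C := by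
    rw [hC, le_div_iff₀ hx.1, one_mul]
    have h1 : (1 : ℝ) ≤ 4 * (G.maxDegree : ℝ) := by linarith
    have h2 : (1 : ℝ) ≤ (Fintype.card V : ℝ) ^ 3 := one_le_pow₀ (by linarith)
    exact hx.2.le.trans (one_le_mul_of_one_le_of_one_le
      (one_le_mul_of_one_le_of_one_le h1 h2) hm)
  have hp : 0 < (x / 4) ^ G.edgeFinset.card := pow_pos (by linarith [hx.1]) _
  set r := C * (-((G.edgeFinset.card : ℝ) * Real.log (x / 4)) - 2 * Real.log δ) with hr
  have hr0 : 0 ≤ r := by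
    have h1 : Real.log (x / 4) ≤ 0 :=
      Real.log_nonpos (by linarith [hx.1]) (by linarith [hx.2])
    have h2 : Real.log δ ≤ 0 := Real.log_nonpos hδ.1.le hδ.2.le
    refine mul_nonneg (by linarith) ?_
    nlinarith
  have : Nonempty (Worm.State G) :=
    ⟨⟨∅, Finset.mem_union_left _ (Worm.empty_mem_config_zero G)⟩⟩
  have hmix : MarkovMixing.worstDist (Worm.transition G x) (Worm.stationary G x) ⌈r⌉₊ ≤ δ := by
    refine (Worm.isLazyStationary G hx.1 (by omega) fun u => ?_).worstDist_le hC1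
      (Worm.poincare G hx hn (by linarith)) hp (Worm.le_stationary G hx hG hn) hδ.1.le
      (Worm.one_sub_inv_pow_le hC1 hδ.1 hp ?_)
    · exact_mod_cast (Nat.pos_iff_ne_zero.1 (hdeg u))
    · rw [Real.log_pow]
      exact Nat.le_ceil r
  obtain ⟨t, ht, htle⟩ := MarkovMixing.exists_isMixingTime_le hmix
  refine ⟨t, ht, ?_⟩
  calc (t : ℝ) ≤ (⌈r⌉₊ : ℝ) := by exact_mod_cast htle
    _ ≤ r + 1 := (Nat.ceil_lt_add_one hr0).le
    _ ≤ _ := harith
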